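/- Let $m \ge 2$ and $n \ge 0$ be integers, let $\zeta_{2^m} = e^{2\pi i/2^m}$, let $E = \mathbb{Q}(\zeta_{2^m}) \subset \mathbb{C}$ with ring of integers $\mathcal{O}_E$, and let $K = E \cap \mathbb{R}$. Let $B = \begin{pmatrix} 1+i & 1 \\ 0 & 1 \end{pmatrix}$. The $n$-qubit Barnes–Wall lattice over $E$ is the set $B^{\otimes n}\mathcal{O}_E^{2^n}$. Its minimum is the least value of $\mathrm{Tr}_{K/\mathbb{Q}}\langle\psi|\psi\rangle$ over its non-zero vectors $\psi$, where $\langle\phi|\psi\rangle = \sum_j \phi_j \psi_j^*$, and its minimal vectors are the non-zero lattice vectors at which the minimum is achieved. A Pauli operator is an element of $\pm\{I,X,Y,Z\}^{\otimes n}$. A stabilizer state is a non-zero vector $\psi \in E^{2^n}$ for which there are $n$ pairwise commuting independent Pauli operators $P$ (none is a product of the others) with $P\psi = \psi$. The $n$-qubit Clifford group is the group of unitary matrices generated by $\frac{1+i}{2} I + \frac{1-i}{2} P$ for all Pauli operators $P$. Then the minimum of the $n$-qubit Barnes–Wall lattice over $E$ equals $\frac{\deg E}{2}\cdot 2^n$,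 where $\deg E = [E:\mathbb{Q}]$. Moreover, every minimal vector of the lattice is a stabilizer state, and it can be written as $\zeta_{2^m}^k \cdot (1+i)^n \cdot C|0\rangle^{\otimes n}$ for some element $C$ of the $n$-qubit Clifford group and some integer $k$ with $0 \le k < 2^m$. -/

import Mathlib

noncomputable section

namespace BarnesWall

/-! ### The cyclotomic field `E = ℚ(ζ)`, `ζ = exp (2πi / 2^m)`, as a subfield of `ℂ` -/

/-- The root of unity `exp (2πi / 2^m)` as a complex number. -/
def zetaC (m : ℕ) : ℂ := Complex.exp (2 * Real.pi * Complex.I / (2 ^ m : ℕ))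

/-- The cyclotomic field `E = ℚ(ζ)`, a subfield of `ℂ`. -/
def E (m : ℕ) : IntermediateField ℚ ℂ := IntermediateField.adjoin ℚ {zetaC m}

/-- The root of unity `ζ = exp (2πi / 2^m)` as an element of `E`. -/
def zeta (m : ℕ) : E m := ⟨zetaC m, IntermediateField.mem_adjoin_simple_self ℚ (zetaC m)⟩

/-- The imaginary unit as an element of `E`, see `coe_imag`; meaningful for `m ≥ 2` only. -/
def imag (m : ℕ) : E m := zeta m ^ (2 ^ (m - 2))

theorem coe_imag (m : ℕ) (hm : 2 ≤ m) : ((imag m : E m) : ℂ) = Complex.I := by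
  obtain ⟨k, rfl⟩ := Nat.exists_eq_add_of_le hm
  have h : ((imag (2 + k) : E (2 + k)) : ℂ) = zetaC (2 + k) ^ (2 ^ k) := by
    simp [imag, zeta]
  rw [h, zetaC, ← Complex.exp_nat_mul]
  have h2 : ((2 ^ k : ℕ) : ℂ) * (2 * Real.pi * Complex.I / ((2 ^ (2 + k) : ℕ) : ℂ))
      = Real.pi / 2 * Complex.I := by
    push_cast
    rw [pow_add]
    field_simp
  rw [h2, Complex.exp_pi_div_two_mul_I]

theorem conj_mem_E (m : ℕ) {x : ℂ} (hx : x ∈ E m) : (starRingEnd ℂ) x ∈ E m := by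
  let f : ℂ →ₐ[ℚ] ℂ := (Complex.conjAe.restrictScalars ℚ : ℂ ≃ₐ[ℚ] ℂ).toAlgHom
  have hz : (starRingEnd ℂ) (zetaC m) = (zetaC m)⁻¹ := by
    rw [zetaC, ← Complex.exp_conj, ← Complex.exp_neg]
    congr 1
    simp [neg_div, map_ofNat]
  have hle : E m ≤ (E m).comap f := by
    unfold E
    rw [IntermediateField.adjoin_le_iff]
    rintro _ rfl
    change (starRingEnd ℂ) (zetaC m) ∈ E m
    rw [hz]
    exact inv_mem (zeta m).2
  exact hle hx

/-- Complex conjugation on `E`. -/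
instance instStarRingE (m : ℕ) : StarRing (E m) where
  star x := ⟨(starRingEnd ℂ) (x : ℂ), conj_mem_E m x.2⟩
  star_involutive x := Subtype.ext (Complex.conj_conj (x : ℂ))
  star_mul x y := Subtype.ext (((starRingEnd ℂ).map_mul (x : ℂ) y).trans (mul_comm _ _))
  star_add x y := Subtype.ext ((starRingEnd ℂ).map_add (x : ℂ) y)

/-- The real subfield `K = E ∩ ℝ` of `E`. -/
def realSubfield (m : ℕ) : IntermediateField ℚ (E m) where
  carrier := {x | (x : ℂ).im = 0}
  mul_mem' {x y} hx hy := by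
    simp only [Set.mem_ofPred_eq] at hx hy ⊢
    simp [Complex.mul_im, hx, hy]
  add_mem' {x y} hx hy := by
    simp only [Set.mem_ofPred_eq] at hx hy ⊢
    simp [hx, hy]
  algebraMap_mem' q := by
    simp
  inv_mem' x hx := by
    simp only [Set.mem_ofPred_eq] at hx ⊢
    simp [Complex.inv_im, hx]

/-! ### Vectors indexed by bit strings, lattices, minima -/

/-- Bit strings of length `n`; they index the coordinates of `n`-qubit vectors. -/
abbrev Bits (n : ℕ) : Type := Fin n → Fin 2

/-- The Hermitian inner product `∑ j, φ j * conj (ψ j)` on `E ^ ι`. -/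
def ip {m : ℕ} {ι : Type} [Fintype ι] (φ ψ : ι → E m) : E m := ∑ j, φ j * star (ψ j)

theorem ip_self_mem {m : ℕ} {ι : Type} [Fintype ι] (ψ : ι → E m) :
    ip ψ ψ ∈ realSubfield m := by
  refine sum_mem fun j _ => ?_
  change (((ψ j * star (ψ j) : E m)) : ℂ).im = 0
  change ((ψ j : ℂ) * (starRingEnd ℂ) (ψ j : ℂ)).im = 0
  rw [Complex.mul_conj]
  exact Complex.ofReal_im _

/-- The rational number `Tr_{K/ℚ} ⟨ψ|ψ⟩`. -/
def traceNorm {m : ℕ} {ι : Type} [Fintype ι] (ψ : ι → E m) : ℚ :=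
  Algebra.trace ℚ (realSubfield m) ⟨ip ψ ψ, ip_self_mem ψ⟩

/-- The lattice `M 𝓞_E ^ ι` with basis matrix `M`. -/
def latticeOfBasis {m : ℕ} {ι : Type} [Fintype ι] (M : Matrix ι ι (E m)) : Set (ι → E m) :=
  Set.range fun w : ι → NumberField.RingOfIntegers (E m) => M.mulVec fun j => (w j : E m)

/-- `q` is the minimum of `Tr_{K/ℚ} ⟨ψ|ψ⟩` over the non-zero vectors `ψ` of `L`. -/
def IsMinimum {m : ℕ} {ι : Type} [Fintype ι] (L : Set (ι → E m)) (q : ℚ) : Prop :=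
  IsLeast {r : ℚ | ∃ ψ ∈ L, ψ ≠ 0 ∧ traceNorm ψ = r} q

/-- `ψ` is a vector of `L` on which the minimum of `L` is achieved. -/
def IsMinimalVector {m : ℕ} {ι : Type} [Fintype ι] (L : Set (ι → E m)) (ψ : ι → E m) : Prop :=
  ψ ∈ L ∧ ψ ≠ 0 ∧ IsMinimum L (traceNorm ψ)

/-- The tensor (Kronecker) product `M 0 ⊗ ⋯ ⊗ M (n - 1)` of two by two matrices. -/
def tensor {m n : ℕ} (M : Fin n → Matrix (Fin 2) (Fin 2) (E m)) :
    Matrix (Bits n) (Bits n) (E m) :=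
  Matrix.of fun a b => ∏ k, M k (a k) (b k)

/-- The basis matrix of the one-qubit Barnes-Wall lattice. -/
def basisMatrix (m : ℕ) : Matrix (Fin 2) (Fin 2) (E m) := !![1 + imag m, 1; 0, 1]

/-- The `n`-qubit Barnes-Wall lattice over `E`, with basis matrix the `n`-th tensor power of
`basisMatrix m`. -/
def lattice (m n : ℕ) : Set (Bits n → E m) :=
  latticeOfBasis (tensor fun _ : Fin n => basisMatrix m)

/-! ### Pauli operators, stabilizer states, the Clifford group -/

/-- The four Pauli matrices `I`, `X`, `Y`, `Z`. -/
def pauliMatrices (m : ℕ) : Set (Matrix (Fin 2) (Fin 2) (E m)) :=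
  {1, !![0, 1; 1, 0], !![0, -imag m; imag m, 0], !![1, 0; 0, -1]}

/-- The `n`-qubit Pauli operators `± {I, X, Y, Z}^{⊗ n}`. -/
def IsPauli {m n : ℕ} (P : Matrix (Bits n) (Bits n) (E m)) : Prop :=
  ∃ M : Fin n → Matrix (Fin 2) (Fin 2) (E m),
    (∀ k, M k ∈ pauliMatrices m) ∧ (P = tensor M ∨ P = -tensor M)

/-- A non-zero `n`-qubit vector that is stabilized by `n` independent commuting Pauli operators.
Independence means that none of the operators is a product of the others. -/
def IsStabilizerState {m n : ℕ} (ψ : Bits n → E m) : Prop :=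
  ψ ≠ 0 ∧ ∃ P : Fin n → Matrix (Bits n) (Bits n) (E m),
    (∀ j, IsPauli (P j)) ∧
    (∀ j k, Commute (P j) (P k)) ∧
    (∀ j, P j ∉ Submonoid.closure (P '' {k | k ≠ j})) ∧
    ∀ j, (P j).mulVec ψ = ψ

/-- The `n`-qubit Clifford group: the group of unitaries generated by the unitary matrices
`(1 + i) / 2 + (1 - i) / 2 * P` for all Pauli operators `P`. -/
def cliffordGroup (m n : ℕ) : Subgroup (Matrix.unitaryGroup (Bits n) (E m)) :=
  Subgroup.closure {U | ∃ P : Matrix (Bits n) (Bits n) (E m), IsPauli P ∧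
    (U : Matrix (Bits n) (Bits n) (E m)) =
      ((1 + imag m) / 2) • (1 : Matrix (Bits n) (Bits n) (E m)) + ((1 - imag m) / 2) • P}

/-- The vector `|0⟩^{⊗ n}`. -/
def ketZero (m n : ℕ) : Bits n → E m := Pi.single 0 1

end BarnesWall

end

noncomputable section

namespace BarnesWall

/-! ### The field `E` -/

/-! Everything goes by induction on the number of qubits. By `mem_lattice_succ`, the halves of a
lattice vector (split by the first bit) are `(1 + i) x + y` and `y`, with `x`, `y` in the smaller
lattice. If one half vanishes, the other is `1 + i` times a lattice vector, and `1 + i` doubles the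
trace form; otherwise both halves are non-zero lattice vectors. Either way the minimum at least
doubles (`le_traceNorm`). For `n = 0` the bound is the inequality of arithmetic and geometric means
for the conjugates of a non-zero integer, whose norm is at least 1; equality puts all conjugates on
the unit circle, so by Kronecker the integer is a root of unity.

For minimal vectors, equality holds in this induction. If a half vanishes, a Clifford operator on
the remaining qubits, preceded by a Pauli flip if necessary, does the job. Otherwise both halves are
minimal and congruent modulo `1 + i`. Pauli operators act trivially modulo `1 + i`, so Clifford
operators preserve the lattice (`mulVec_mem_lattice`), and the upper half may be moved to `(1 + i)^n
|0⟩`. A minimal vector congruent to it is `c (1 + i)^n |b⟩` with `c^4 = 1`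
(`eq_single_of_congr_ketZero`); that `c` is only a fourth root of unity, although `E` may have many
more, is `pow_four_eq_one_of_congr`. Up to a scalar, `|0⟩|0⟩ + c |1⟩|b⟩` is one Clifford generator
applied to `|0⟩`. Finally, Clifford operators normalize the Pauli operators (`IsPauli.conj`), so
every such vector is a stabilizer state. -/

theorem isPrimitiveRoot_zetaC (m : ℕ) : IsPrimitiveRoot (zetaC m) (2 ^ m) :=
  Complex.isPrimitiveRoot_exp (2 ^ m) (by positivity)

theorem isPrimitiveRoot_zeta (m : ℕ) : IsPrimitiveRoot (zeta m) (2 ^ m) :=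
  IsPrimitiveRoot.of_map_of_injective (f := (E m).val) (isPrimitiveRoot_zetaC m)
    (E m).val.injective

theorem isIntegral_zetaC (m : ℕ) : IsIntegral ℚ (zetaC m) :=
  (isPrimitiveRoot_zetaC m).isIntegral (by positivity) |>.tower_top

instance instNumberFieldE (m : ℕ) : NumberField (E m) where
  to_charZero := inferInstance
  to_finiteDimensional := IntermediateField.adjoin.finiteDimensional (isIntegral_zetaC m)

instance instIsCyclotomicExtensionE (m : ℕ) : IsCyclotomicExtension {2 ^ m} ℚ (E m) := by
  change IsCyclotomicExtension {2 ^ m} ℚ (IntermediateField.adjoin ℚ {zetaC m}).toSubalgebra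
  rw [IntermediateField.adjoin_simple_toSubalgebra_of_isAlgebraic
    (isIntegral_zetaC m).isAlgebraic]
  exact (isPrimitiveRoot_zetaC m).adjoin_isCyclotomicExtension ℚ

theorem zeta_pow_two_pow (m : ℕ) : zeta m ^ (2 ^ m) = 1 := (isPrimitiveRoot_zeta m).pow_eq_one

theorem imag_mul_self {m : ℕ} (hm : 2 ≤ m) : imag m * imag m = -1 := by
  apply Subtype.ext
  change ((imag m : E m) : ℂ) * ((imag m : E m) : ℂ) = -1
  rw [coe_imag m hm, Complex.I_mul_I]

theorem star_imag {m : ℕ} (hm : 2 ≤ m) : star (imag m) = -imag m := by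
  apply Subtype.ext
  change (starRingEnd ℂ) ((imag m : E m) : ℂ) = -((imag m : E m) : ℂ)
  rw [coe_imag m hm, Complex.conj_I]

theorem zeta_mul_star (m : ℕ) : zeta m * star (zeta m) = 1 := by
  apply Subtype.ext
  change zetaC m * (starRingEnd ℂ) (zetaC m) = 1
  rw [Complex.mul_conj, Complex.normSq_eq_norm_sq,
    Complex.norm_eq_one_of_pow_eq_one (isPrimitiveRoot_zetaC m).pow_eq_one (by positivity)]
  simp

theorem isIntegral_zeta (m : ℕ) : IsIntegral ℤ (zeta m) :=
  (isPrimitiveRoot_zeta m).isIntegral (by positivity)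

theorem isIntegral_imag (m : ℕ) : IsIntegral ℤ (imag m) := (isIntegral_zeta m).pow _

theorem ofNat_two_eq {m : ℕ} (hm : 2 ≤ m) : (2 : E m) = (1 + imag m) * (1 - imag m) := by
  linear_combination imag_mul_self hm

theorem one_add_imag_ne_zero {m : ℕ} (hm : 2 ≤ m) : (1 + imag m : E m) ≠ 0 := by
  intro h
  have h2 := ofNat_two_eq hm
  rw [h, zero_mul] at h2
  exact two_ne_zero h2

/-- `E` is generated by `ζ`, and both sides send `ζ` to the inverse of `σ ζ`, which lies on the unit
circle. -/
theorem embedding_star {m : ℕ} (σ : E m →ₐ[ℚ] ℂ) (x : E m) :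
    σ (star x) = (starRingEnd ℂ) (σ x) := by
  let c : ℂ →ₐ[ℚ] ℂ := (Complex.conjAe.restrictScalars ℚ : ℂ ≃ₐ[ℚ] ℂ).toAlgHom
  let s : E m →ₐ[ℚ] E m :=
    { toFun := fun x => star x
      map_one' := star_one _
      map_mul' := fun x y => by rw [star_mul, mul_comm]
      map_zero' := star_zero _
      map_add' := star_add
      commutes' := fun q => by
        apply Subtype.ext
        change (starRingEnd ℂ) (algebraMap ℚ ℂ q) = algebraMap ℚ ℂ q
        simp }
  suffices h : σ.comp s = c.comp σ from DFunLike.congr_fun h x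
  refine IntermediateField.algHom_ext_of_eq_adjoin (S := E m) ℚ rfl ?_
  rintro _ rfl
  change σ (star (zeta m)) = (starRingEnd ℂ) (σ (zeta m))
  have h1 : σ (zeta m) * σ (star (zeta m)) = 1 := by
    rw [← map_mul, zeta_mul_star, map_one]
  have h2 : σ (zeta m) * (starRingEnd ℂ) (σ (zeta m)) = 1 := by
    rw [Complex.mul_conj, Complex.normSq_eq_norm_sq,
      Complex.norm_eq_one_of_pow_eq_one (n := 2 ^ m)
        (by rw [← map_pow, zeta_pow_two_pow, map_one]) (by positivity)]
    simp
  have h0 : σ (zeta m) ≠ 0 := left_ne_zero_of_mul_eq_one h1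
  exact mul_left_cancel₀ h0 (h1.trans h2.symm)

/-- As `i` lies in `E` for `m ≥ 2`, real and imaginary parts can be taken inside `E`, and `1`, `i`
form a basis. -/
theorem finrank_realSubfield {m : ℕ} (hm : 2 ≤ m) : Module.finrank (realSubfield m) (E m) = 2 := by
  have him := coe_imag m hm
  have hI := imag_mul_self hm
  have hsI := star_imag hm
  let v : Fin 2 → E m := ![1, imag m]
  have hreal : ∀ x : E m, star x = x → x ∈ realSubfield m := fun x hx => by
    change (x : ℂ).im = 0
    have h := congrArg (fun y : E m => (y : ℂ)) hx
    exact Complex.conj_eq_iff_im.1 h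
  have hli : LinearIndependent (realSubfield m) v := by
    rw [LinearIndependent.pair_iff]
    intro s t h
    have h' : ((s : E m) : ℂ) * 1 + ((t : E m) : ℂ) * Complex.I = 0 := by
      rw [← him]
      exact congrArg (fun y : E m => (y : ℂ)) h
    have hs : ((s : E m) : ℂ).im = 0 := s.2
    have ht : ((t : E m) : ℂ).im = 0 := t.2
    have h1 := congrArg Complex.re h'
    have h2 := congrArg Complex.im h'
    simp [hs, ht] at h1 h2
    refine ⟨Subtype.ext (Subtype.ext ?_), Subtype.ext (Subtype.ext ?_)⟩
    · exact Complex.ext h1 hs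
    · exact Complex.ext h2 ht
  have hsp : ⊤ ≤ Submodule.span (realSubfield m) (Set.range v) := by
    intro x _
    have ha : (x + star x) / 2 ∈ realSubfield m :=
      hreal _ (by rw [star_div₀, star_add, star_star, add_comm]; simp)
    have hb : (x - star x) / 2 * -imag m ∈ realSubfield m :=
      hreal _ (by
        rw [star_mul, star_div₀, star_sub, star_star, star_neg, hsI, star_ofNat]; ring)
    have h1 : (1 : E m) ∈ Submodule.span (realSubfield m) (Set.range v) :=
      Submodule.subset_span ⟨0, rfl⟩
    have h2 : imag m ∈ Submodule.span (realSubfield m) (Set.range v) :=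
      Submodule.subset_span ⟨1, rfl⟩
    have key : x = (⟨_, ha⟩ : realSubfield m) • (1 : E m) +
        (⟨_, hb⟩ : realSubfield m) • imag m := by
      change x = (x + star x) / 2 * 1 + (x - star x) / 2 * -imag m * imag m
      linear_combination (x - star x) / 2 * hI
    rw [key]
    exact add_mem (Submodule.smul_mem _ _ h1) (Submodule.smul_mem _ _ h2)
  simpa using Module.finrank_eq_card_basis (Module.Basis.mk hli hsp)

/-! ### The trace form in terms of complex embeddings -/

/-- The degree of `E` over its real subfield being two, the trace from the real subfield is half
the trace from `E`. -/
theorem two_mul_trace_realSubfield {m : ℕ} (hm : 2 ≤ m) (a : realSubfield m) :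
    2 * Algebra.trace ℚ (realSubfield m) a = Algebra.trace ℚ (E m) (a : E m) := by
  have h : Algebra.trace (realSubfield m) (E m) (a : E m) = 2 • a := by
    rw [← finrank_realSubfield hm]
    exact Algebra.trace_algebraMap (S := E m) a
  rw [← Algebra.trace_trace (S := realSubfield m) (a : E m), h, map_nsmul, nsmul_eq_mul]
  norm_num

/-- This turns the trace form into a sum of squared absolute values, to which real inequalities
apply. The factor 2 comes from passing to the embeddings of `E` instead of those of `K`. -/
theorem two_mul_traceNorm {m : ℕ} (hm : 2 ≤ m) {ι : Type} [Fintype ι] (ψ : ι → E m) :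
    2 * (traceNorm ψ : ℝ) = ∑ j, ∑ σ : E m →ₐ[ℚ] ℂ, ‖σ (ψ j)‖ ^ 2 := by
  have h : ((2 * traceNorm ψ : ℚ) : ℂ) = ∑ j, ∑ σ : E m →ₐ[ℚ] ℂ, ((‖σ (ψ j)‖ ^ 2 : ℝ) : ℂ) := by
    rw [traceNorm, two_mul_trace_realSubfield hm]
    change algebraMap ℚ ℂ _ = _
    rw [trace_eq_sum_embeddings ℂ, Finset.sum_comm]
    refine Finset.sum_congr rfl fun σ _ => ?_
    change σ (∑ j, ψ j * star (ψ j)) = _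
    rw [map_sum]
    refine Finset.sum_congr rfl fun j _ => ?_
    rw [map_mul, embedding_star, Complex.mul_conj, Complex.normSq_eq_norm_sq]
  exact_mod_cast h

theorem card_embeddings (m : ℕ) :
    Fintype.card (E m →ₐ[ℚ] ℂ) = Module.finrank ℚ (E m) := AlgHom.card ℚ (E m) ℂ

/-- The product of the `‖σ x‖ ^ 2` is the square of a non-zero integer norm, so their logarithms
have non-negative sum. Summing `log t ≤ t - 1` gives the bound; since that inequality is strict for
`t ≠ 1`, equality makes every term 1. -/
theorem finrank_le_sum_embeddings {m : ℕ} {x : E m} (hx : IsIntegral ℤ x) (h0 : x ≠ 0) :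
    (Module.finrank ℚ (E m) : ℝ) ≤ ∑ σ : E m →ₐ[ℚ] ℂ, ‖σ x‖ ^ 2 ∧
    (∑ σ : E m →ₐ[ℚ] ℂ, ‖σ x‖ ^ 2 = (Module.finrank ℚ (E m) : ℝ) →
      ∀ σ : E m →ₐ[ℚ] ℂ, ‖σ x‖ = 1) := by
  have hpos : ∀ σ : E m →ₐ[ℚ] ℂ, 0 < ‖σ x‖ ^ 2 := fun σ => by
    have : σ x ≠ 0 := (map_ne_zero σ).2 h0
    positivity
  have hnorm : (1 : ℝ) ≤ ∏ σ : E m →ₐ[ℚ] ℂ, ‖σ x‖ ^ 2 := by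
    obtain ⟨x, rfl⟩ : ∃ y : NumberField.RingOfIntegers (E m), (y : E m) = x := ⟨⟨x, hx⟩, rfl⟩
    have h1 : (1 : ℝ) ≤ ∏ σ : E m →ₐ[ℚ] ℂ, ‖σ x‖ := by
      rw [← norm_prod, ← Algebra.norm_eq_prod_embeddings ℚ ℂ, ← Algebra.coe_norm_int]
      simp only [map_intCast, Complex.norm_intCast]
      have : (Algebra.norm ℤ x) ≠ 0 := Algebra.norm_ne_zero_iff.2 fun h => h0 (by simp [h])
      exact_mod_cast Int.one_le_abs this
    rw [Finset.prod_pow]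
    exact one_le_pow₀ h1
  have hlog : 0 ≤ ∑ σ : E m →ₐ[ℚ] ℂ, Real.log (‖σ x‖ ^ 2) := by
    rw [← Real.log_prod fun σ _ => (hpos σ).ne']
    exact Real.log_nonneg hnorm
  have hterm : ∀ σ : E m →ₐ[ℚ] ℂ, 0 ≤ ‖σ x‖ ^ 2 - 1 - Real.log (‖σ x‖ ^ 2) := fun σ => by
    linarith [Real.log_le_sub_one_of_pos (hpos σ)]
  have hsum : ∑ σ : E m →ₐ[ℚ] ℂ, (‖σ x‖ ^ 2 - 1 - Real.log (‖σ x‖ ^ 2)) =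
      ∑ σ : E m →ₐ[ℚ] ℂ, ‖σ x‖ ^ 2 - Module.finrank ℚ (E m) -
        ∑ σ : E m →ₐ[ℚ] ℂ, Real.log (‖σ x‖ ^ 2) := by
    rw [Finset.sum_sub_distrib, Finset.sum_sub_distrib, ← card_embeddings]
    simp
  have hnn := Finset.sum_nonneg fun σ (_ : σ ∈ Finset.univ) => hterm σ
  refine ⟨by linarith, fun h σ => ?_⟩
  have hz : ∑ σ : E m →ₐ[ℚ] ℂ, (‖σ x‖ ^ 2 - 1 - Real.log (‖σ x‖ ^ 2)) = 0 := by linarith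
  have hσ := (Finset.sum_eq_zero_iff_of_nonneg fun σ _ => hterm σ).1 hz σ (Finset.mem_univ _)
  have h1 : ‖σ x‖ ^ 2 = 1 := by
    by_contra hne
    linarith [Real.log_lt_sub_one_of_pos (hpos σ) hne]
  exact (pow_eq_one_iff_of_nonneg (norm_nonneg _) two_ne_zero).1 h1

/-- Kronecker's theorem in `E`. -/
theorem exists_eq_zeta_pow {m : ℕ} (hm : 2 ≤ m) {x : E m} (hx : IsIntegral ℤ x)
    (h : ∀ σ : E m →ₐ[ℚ] ℂ, ‖σ x‖ = 1) : ∃ k : ℕ, x = zeta m ^ k := by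
  obtain ⟨l, hl, hxl⟩ := NumberField.Embeddings.pow_eq_one_of_norm_eq_one (E m) ℂ hx
    fun φ => h φ.toRatAlgHom
  have hfin : IsOfFinOrder x := isOfFinOrder_iff_pow_eq_one.2 ⟨l, hl, hxl⟩
  have : NeZero (orderOf x) := ⟨hfin.orderOf_pos.ne'⟩
  -- The torsion order of `E` is `2 ^ m` itself, not twice that, because `2 ^ m` is even.
  have hdvd := NumberField.Units.dvd_torsionOrder_of_isPrimitiveRoot (IsPrimitiveRoot.orderOf x)
  rw [IsCyclotomicExtension.Rat.torsionOrder_eq (n := 2 ^ m),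
    if_pos ((even_two (α := ℕ)).pow_of_ne_zero (by omega))] at hdvd
  obtain ⟨k, -, hk⟩ := (isPrimitiveRoot_zeta m).eq_pow_of_pow_eq_one
    (orderOf_dvd_iff_pow_eq_one.1 hdvd)
  exact ⟨k, hk.symm⟩

/-- A unit of absolute value one that is congruent to `1` modulo `1 + i` is a
fourth root of unity. -/
theorem pow_four_eq_one_of_congr {m : ℕ} (hm : 2 ≤ m) {x w : E m}
    (h : ∀ σ : E m →ₐ[ℚ] ℂ, ‖σ x‖ = 1) (hw : IsIntegral ℤ w) (hxw : x - 1 = (1 + imag m) * w) :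
    x ^ 4 = 1 := by
  have hI := imag_mul_self hm
  set p := 1 + imag m with hp
  set q := 1 - imag m with hq
  have hqI : IsIntegral ℤ q := isIntegral_one.sub (isIntegral_imag m)
  have hiI := isIntegral_imag m
  have h2 : p * q = 2 := (ofNat_two_eq hm).symm
  -- Since `1 + i` divides `x - 1`, it divides `x + 1`, `x - i` and `x + i` too; the factors of `W`
  -- are the four cofactors. With `(1 + i)^4 = -4` this gives `x^4 - 1 = -4 W`.
  let W := w * (w + q) * (w - imag m) * (w + 1)
  have hW : IsIntegral ℤ W :=
    (((hw.mul (hw.add hqI)).mul (hw.sub hiI)).mul (hw.add isIntegral_one))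
  have hfac : x ^ 4 - 1 = (x - 1) * (x + 1) * (x - imag m) * (x + imag m) := by
    linear_combination (x ^ 2 - 1) * hI
  have hx4 : x ^ 4 - 1 = -4 * W := by
    have e1 : x + 1 = p * (w + q) := by linear_combination hxw - h2
    have e2 : x - imag m = p * (w - imag m) := by
      rw [hp]; rw [hp] at hxw; linear_combination hxw + hI
    have e3 : x + imag m = p * (w + 1) := by rw [hp]; rw [hp] at hxw; linear_combination hxw
    have e4 : p ^ 4 = -4 := by
      rw [hp]; linear_combination (imag m ^ 2 + 4 * imag m + 5) * hI
    rw [hfac, hxw, e1, e2, e3, ← e4]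
    ring
  have hW0 : W = 0 := by
    by_contra hne
    have hle := (finrank_le_sum_embeddings hW hne).1
    -- All conjugates of `x^4 - 1` have absolute value at most 2, so those of `W` are at most 1/2,
    -- too small for a non-zero integer.
    have hb : ∀ σ : E m →ₐ[ℚ] ℂ, ‖σ W‖ ^ 2 ≤ 1 / 4 := fun σ => by
      have e : σ x ^ 4 - 1 = -4 * σ W := by
        have := congrArg σ hx4
        rw [map_sub, map_pow, map_one, map_mul, map_neg, map_ofNat] at this
        exact this
      have : 4 * ‖σ W‖ ≤ 2 := by
        calc 4 * ‖σ W‖ = ‖σ x ^ 4 - 1‖ := by rw [e]; simp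
          _ ≤ ‖σ x ^ 4‖ + ‖(1 : ℂ)‖ := norm_sub_le _ _
          _ = 2 := by rw [norm_pow, h σ]; norm_num
      nlinarith [norm_nonneg (σ W)]
    have hs := Finset.sum_le_sum fun σ (_ : σ ∈ Finset.univ) => hb σ
    rw [Finset.sum_const, Finset.card_univ, card_embeddings, nsmul_eq_mul] at hs
    have hpos : (0 : ℝ) < Module.finrank ℚ (E m) := by exact_mod_cast Module.finrank_pos
    linarith
  rwa [hW0, mul_zero, sub_eq_zero] at hx4

/-! ### Elementary properties of the trace form -/

/-- A shortcut for the scalar multiplication of vectors over `E`. -/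
abbrev vecSMul (m : ℕ) (ι : Type) : SMul (E m) (ι → E m) := Function.hasSMul

/-- A shortcut for the vector space structure of vectors over `E`. -/
abbrev vecModule (m : ℕ) (ι : Type) : Module (E m) (ι → E m) := Pi.Function.module _ _ _

attribute [local instance] vecSMul vecModule

section TraceNorm

variable {m : ℕ} {ι : Type} [Fintype ι]

theorem traceNorm_eq_mul {κ : Type} [Fintype κ] {φ : ι → E m} {ψ : κ → E m} (q : ℚ)
    (h : ip φ φ = (q : E m) * ip ψ ψ) : traceNorm φ = q * traceNorm ψ := by
  rw [traceNorm, traceNorm, ← smul_eq_mul, ← map_smul]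
  congr 1
  apply Subtype.ext
  change ip φ φ = q • ip ψ ψ
  rw [h, Rat.smul_def]

theorem ip_smul_self (c : E m) (ψ : ι → E m) :
    ip (c • ψ) (c • ψ) = c * star c * ip ψ ψ := by
  simp only [ip, Finset.mul_sum, Pi.smul_apply, smul_eq_mul, star_mul]
  exact Finset.sum_congr rfl fun _ _ => by ring

theorem traceNorm_smul_of_unit {c : E m} (hc : c * star c = 1) (ψ : ι → E m) :
    traceNorm (c • ψ) = traceNorm ψ := by
  simpa using traceNorm_eq_mul (φ := c • ψ) (ψ := ψ) 1 (by rw [ip_smul_self, hc]; simp)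

theorem traceNorm_one_add_imag_smul (hm : 2 ≤ m) (ψ : ι → E m) :
    traceNorm ((1 + imag m) • ψ) = 2 * traceNorm ψ := by
  refine traceNorm_eq_mul 2 ?_
  rw [ip_smul_self, star_add, star_one, star_imag hm, ← sub_eq_add_neg, ← ofNat_two_eq hm]
  simp

theorem traceNorm_zero : traceNorm (0 : ι → E m) = 0 := by
  simpa using traceNorm_eq_mul (φ := (0 : ι → E m)) (ψ := (0 : ι → E m)) 0 (by simp [ip])

theorem ip_eq_dotProduct (φ ψ : ι → E m) : ip φ ψ = φ ⬝ᵥ star ψ := rfl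

theorem traceNorm_mulVec_unitary [DecidableEq ι] (U : Matrix.unitaryGroup ι (E m))
    (ψ : ι → E m) : traceNorm ((U : Matrix ι ι (E m)).mulVec ψ) = traceNorm ψ := by
  have h : (U : Matrix ι ι (E m)).conjTranspose * (U : Matrix ι ι (E m)) = 1 :=
    Matrix.UnitaryGroup.star_mul_self U
  simpa using traceNorm_eq_mul (φ := (U : Matrix ι ι (E m)).mulVec ψ) (ψ := ψ) 1 (by
    rw [ip_eq_dotProduct, Matrix.star_mulVec, dotProduct_comm, ← Matrix.dotProduct_mulVec,
      Matrix.mulVec_mulVec, h, Matrix.one_mulVec, dotProduct_comm, ip_eq_dotProduct]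
    simp)

end TraceNorm

/-! ### Splitting off the first qubit -/

section Halves

variable {m n : ℕ}

/-- The coordinates of `ψ` at the bit strings that begin with `a`. -/
def half (a : Fin 2) (ψ : Bits (n + 1) → E m) : Bits n → E m :=
  fun b => ψ (Fin.cons a b : Bits (n + 1))

/-- The vector with halves `x` and `y`. -/
def join {α : Type} (x y : Bits n → α) : Bits (n + 1) → α :=
  fun b => if b 0 = 0 then x (Fin.tail b) else y (Fin.tail b)

@[simp] theorem half_zero_join (x y : Bits n → E m) : half 0 (join x y) = x := by
  ext b; simp [half, join]

@[simp] theorem half_one_join (x y : Bits n → E m) : half 1 (join x y) = y := by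
  ext b; simp [half, join]

@[simp] theorem half_add (a : Fin 2) (φ ψ : Bits (n + 1) → E m) :
    half a (φ + ψ) = half a φ + half a ψ := rfl

@[simp] theorem half_sub (a : Fin 2) (φ ψ : Bits (n + 1) → E m) :
    half a (φ - ψ) = half a φ - half a ψ := rfl

@[simp] theorem half_smul (a : Fin 2) (c : E m) (ψ : Bits (n + 1) → E m) :
    half a (c • ψ) = c • half a ψ := rfl

theorem half_ext {φ ψ : Bits (n + 1) → E m} (h0 : half 0 φ = half 0 ψ)
    (h1 : half 1 φ = half 1 ψ) : φ = ψ := by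
  funext b
  rw [← Fin.cons_self_tail b]
  generalize b 0 = a
  fin_cases a
  · exact congrFun h0 (Fin.tail b)
  · exact congrFun h1 (Fin.tail b)

theorem sum_bits_succ {α : Type*} [AddCommMonoid α] (f : Bits (n + 1) → α) :
    ∑ b, f b = ∑ b : Bits n, f (Fin.cons 0 b : Bits (n + 1)) +
      ∑ b : Bits n, f (Fin.cons 1 b : Bits (n + 1)) := by
  rw [← (Fin.consEquiv fun _ : Fin (n + 1) => Fin 2).sum_comp, Fintype.sum_prod_type,
    Fin.sum_univ_two]
  rfl

theorem traceNorm_succ (ψ : Bits (n + 1) → E m) :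
    traceNorm ψ = traceNorm (half 0 ψ) + traceNorm (half 1 ψ) := by
  rw [traceNorm, traceNorm, traceNorm, ← map_add]
  congr 1
  apply Subtype.ext
  exact sum_bits_succ _

/-- The block form of a tensor product along the first qubit, which opens the way to induction on
`n`. -/
theorem half_tensor_mulVec (M : Fin (n + 1) → Matrix (Fin 2) (Fin 2) (E m)) (a : Fin 2)
    (ψ : Bits (n + 1) → E m) :
    half a ((tensor M).mulVec ψ) =
      M 0 a 0 • (tensor fun k => M k.succ).mulVec (half 0 ψ) +
      M 0 a 1 • (tensor fun k => M k.succ).mulVec (half 1 ψ) := by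
  ext b
  simp only [half, Matrix.mulVec, dotProduct, sum_bits_succ, tensor, Matrix.of_apply,
    Fin.prod_univ_succ, Fin.cons_zero, Fin.cons_succ, Pi.add_apply, Pi.smul_apply, smul_eq_mul,
    Finset.mul_sum, mul_assoc]

theorem half_single (a a' : Fin 2) (b : Bits n) :
    half a (Pi.single (Fin.cons a' b : Bits (n + 1)) 1 : Bits (n + 1) → E m) =
      if a = a' then Pi.single b 1 else 0 := by
  ext c
  simp only [half, Pi.single_apply, Fin.cons_inj]
  split_ifs <;> simp_all

theorem zero_eq_cons : (0 : Bits (n + 1)) = Fin.cons 0 (0 : Bits n) := by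
  ext k; refine Fin.cases ?_ (fun k => ?_) k <;> simp

@[simp] theorem half_zero_ketZero : half 0 (ketZero m (n + 1)) = ketZero m n := by
  rw [ketZero, zero_eq_cons, half_single, if_pos rfl]; rfl

@[simp] theorem half_one_ketZero : half 1 (ketZero m (n + 1)) = 0 := by
  rw [ketZero, zero_eq_cons, half_single, if_neg (by decide)]

end Halves

/-! ### The lattice -/

section Lattice

variable {m n : ℕ}

theorem add_mem_lattice {φ ψ : Bits n → E m} (hφ : φ ∈ lattice m n) (hψ : ψ ∈ lattice m n) :
    φ + ψ ∈ lattice m n := by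
  obtain ⟨v, rfl⟩ := hφ
  obtain ⟨w, rfl⟩ := hψ
  exact ⟨v + w, Matrix.mulVec_add _ (fun j => (v j : E m)) (fun j => (w j : E m))⟩

theorem smul_mem_lattice {c : E m} (hc : IsIntegral ℤ c) {ψ : Bits n → E m}
    (hψ : ψ ∈ lattice m n) : c • ψ ∈ lattice m n := by
  obtain ⟨w, rfl⟩ := hψ
  let c' : NumberField.RingOfIntegers (E m) := ⟨c, hc⟩
  refine ⟨fun j => c' * w j, ?_⟩
  have e : (fun j => ((c' * w j : NumberField.RingOfIntegers (E m)) : E m)) = c • fun j => (w j : E m) :=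
    funext fun j => map_mul (algebraMap (NumberField.RingOfIntegers (E m)) (E m)) _ _
  change Matrix.mulVec _ _ = c • Matrix.mulVec _ _
  rw [e, Matrix.mulVec_smul]

theorem neg_mem_lattice {ψ : Bits n → E m} (hψ : ψ ∈ lattice m n) : -ψ ∈ lattice m n := by
  rw [← neg_one_smul (E m)]
  exact smul_mem_lattice isIntegral_one.neg hψ

theorem sub_mem_lattice {φ ψ : Bits n → E m} (hφ : φ ∈ lattice m n) (hψ : ψ ∈ lattice m n) :
    φ - ψ ∈ lattice m n := by
  rw [sub_eq_add_neg]
  exact add_mem_lattice hφ (neg_mem_lattice hψ)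

theorem zero_mem_lattice : (0 : Bits n → E m) ∈ lattice m n :=
  ⟨0, by
    change Matrix.mulVec _ (fun _ => ((0 : NumberField.RingOfIntegers (E m)) : E m)) = 0
    simp only [map_zero]
    exact Matrix.mulVec_zero _⟩

theorem isIntegral_one_add_imag (m : ℕ) : IsIntegral ℤ (1 + imag m) :=
  isIntegral_one.add (isIntegral_imag m)

theorem isIntegral_one_sub_imag (m : ℕ) : IsIntegral ℤ (1 - imag m) :=
  isIntegral_one.sub (isIntegral_imag m)

theorem tensor_fin_zero (M : Fin 0 → Matrix (Fin 2) (Fin 2) (E m)) : tensor M = 1 := by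
  refine Matrix.ext fun a b => ?_
  rw [Subsingleton.elim a b, Matrix.one_apply_eq]
  simp [tensor]

theorem mem_lattice_zero {ψ : Bits 0 → E m} :
    ψ ∈ lattice m 0 ↔ IsIntegral ℤ (ψ 0) := by
  constructor
  · rintro ⟨w, rfl⟩
    have h : IsIntegral ℤ (w default : E m) := (w default).2
    change IsIntegral ℤ ((tensor _).mulVec _ 0)
    rw [tensor_fin_zero, Matrix.one_mulVec, Subsingleton.elim (0 : Bits 0) default]
    exact h
  · intro h
    refine ⟨fun _ => ⟨ψ 0, h⟩, ?_⟩
    change (tensor _).mulVec _ = _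
    rw [tensor_fin_zero, Matrix.one_mulVec]
    exact funext fun b => congrArg ψ (Subsingleton.elim _ _)

/-- The block form of `B ⊗ B^{⊗ n}`: the two halves are lattice vectors congruent modulo `1 + i`.
The inductions below see the lattice only in this form. -/
theorem mem_lattice_succ {ψ : Bits (n + 1) → E m} :
    ψ ∈ lattice m (n + 1) ↔ ∃ x ∈ lattice m n, ∃ y ∈ lattice m n,
      half 0 ψ = (1 + imag m) • x + y ∧ half 1 ψ = y := by
  constructor
  · rintro ⟨w, rfl⟩
    refine ⟨_, ⟨fun b => w (Fin.cons 0 b : Bits (n + 1)), rfl⟩,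
      _, ⟨fun b => w (Fin.cons 1 b : Bits (n + 1)), rfl⟩, ?_, ?_⟩
    · rw [half_tensor_mulVec]
      simp [basisMatrix]
      rfl
    · rw [half_tensor_mulVec]
      simp [basisMatrix]
      rfl
  · rintro ⟨_, ⟨v, rfl⟩, _, ⟨w, rfl⟩, h0, h1⟩
    have e0 : half 0 (fun b => ((join v w b : NumberField.RingOfIntegers (E m)) : E m)) = fun b => (v b : E m) := by
      funext b; simp [half, join]
    have e1 : half 1 (fun b => ((join v w b : NumberField.RingOfIntegers (E m)) : E m)) = fun b => (w b : E m) := by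
      funext b; simp [half, join]
    refine ⟨join v w, half_ext ?_ ?_⟩
    · rw [h0, half_tensor_mulVec, e0, e1]
      simp [basisMatrix]
    · rw [h1, half_tensor_mulVec, e1]
      simp [basisMatrix]

theorem ketZero_smul_mem_lattice (m n : ℕ) :
    (1 + imag m) ^ n • ketZero m n ∈ lattice m n := by
  induction n with
  | zero =>
    rw [mem_lattice_zero]
    simpa [ketZero] using isIntegral_one
  | succ n ih =>
    refine mem_lattice_succ.2 ⟨_, ih, 0, zero_mem_lattice, ?_, ?_⟩
    · rw [half_smul, half_zero_ketZero, pow_succ', mul_smul, add_zero]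
    · rw [half_smul, half_one_ketZero, smul_zero]

/-- Tensor products of Pauli matrices act trivially on the lattice modulo `1 + i`. -/
theorem exists_tensor_mulVec_sub {m : ℕ} (hm : 2 ≤ m) {n : ℕ}
    (M : Fin n → Matrix (Fin 2) (Fin 2) (E m))
    (hM : ∀ k, M k ∈ pauliMatrices m) {ψ : Bits n → E m} (hψ : ψ ∈ lattice m n) :
    ∃ z ∈ lattice m n, (tensor M).mulVec ψ - ψ = (1 + imag m) • z := by
  induction n with
  | zero =>
    refine ⟨0, zero_mem_lattice, ?_⟩
    rw [tensor_fin_zero, Matrix.one_mulVec, sub_self, smul_zero]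
  | succ n ih =>
    obtain ⟨x, hx, y, hy, h0, h1⟩ := mem_lattice_succ.1 hψ
    have hM' : ∀ k : Fin n, M k.succ ∈ pauliMatrices m := fun k => hM _
    have hI := imag_mul_self hm
    have hiI := isIntegral_imag m
    have hqI := isIntegral_one_sub_imag m
    obtain ⟨x', hx', ex⟩ := ih (fun k => M k.succ) hM' hx
    obtain ⟨y', hy', ey⟩ := ih (fun k => M k.succ) hM' hy
    set T := tensor fun k => M k.succ
    have hTx : T.mulVec x = x + (1 + imag m) • x' := by rw [← ex]; abel
    have hTy : T.mulVec y = y + (1 + imag m) • y' := by rw [← ey]; abel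
    have hTxL : T.mulVec x ∈ lattice m n := by
      rw [hTx]; exact add_mem_lattice hx (smul_mem_lattice (isIntegral_one_add_imag m) hx')
    suffices h : ∃ u ∈ lattice m n, ∃ v ∈ lattice m n,
        M 0 0 0 • T.mulVec ((1 + imag m) • x + y) + M 0 0 1 • T.mulVec y
            - ((1 + imag m) • x + y) = (1 + imag m) • ((1 + imag m) • u + v) ∧
        M 0 1 0 • T.mulVec ((1 + imag m) • x + y) + M 0 1 1 • T.mulVec y - y =
          (1 + imag m) • v by
      obtain ⟨u, hu, v, hv, e0, e1⟩ := h
      refine ⟨join ((1 + imag m) • u + v) v,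
        mem_lattice_succ.2 ⟨u, hu, v, hv, half_zero_join _ _, half_one_join _ _⟩,
        half_ext ?_ ?_⟩
      · rw [half_sub, half_tensor_mulVec, h0, h1, half_smul, half_zero_join]
        exact e0
      · rw [half_sub, half_tensor_mulVec, h0, h1, half_smul, half_one_join]
        exact e1
    rw [Matrix.mulVec_add, Matrix.mulVec_smul, hTx, hTy]
    -- In each case `v` is the lower difference divided by `1 + i`; then `u` is obtained by dividing
    -- the upper one by `1 + i`, subtracting `v` and dividing again. Factors of 2 are absorbed by `2
    -- = (1 + i)(1 - i)`.
    rcases hM 0 with h | h | h | h <;> rw [h]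
    · refine ⟨x', hx', y', hy', ?_, ?_⟩ 
      · funext b
        simp
        ring
      · funext b
        simp
    · refine ⟨-((1 - imag m) • x) - x',
        sub_mem_lattice (neg_mem_lattice (smul_mem_lattice hqI hx)) hx',
        x + (1 + imag m) • x' + y', add_mem_lattice (hTx ▸ hTxL) hy', ?_, ?_⟩
      · funext b
        simp
        linear_combination -(1 + imag m) * x b * hI
      · funext b
        simp
        ring
    · refine ⟨-y - (imag m * (1 - imag m)) • y' - x - imag m • x',
        sub_mem_lattice (sub_mem_lattice (sub_mem_lattice (neg_mem_lattice hy)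
          (smul_mem_lattice (hiI.mul hqI) hy')) hx) (smul_mem_lattice hiI hx'),
        imag m • (x + (1 + imag m) • x') + imag m • y' + imag m • y,
        add_mem_lattice (add_mem_lattice (smul_mem_lattice hiI (hTx ▸ hTxL))
          (smul_mem_lattice hiI hy')) (smul_mem_lattice hiI hy), ?_, ?_⟩
      · funext b
        simp
        linear_combination (-imag m - imag m ^ 2) * y' b * hI
      · funext b
        simp
        linear_combination -y b * hI
    · refine ⟨x' + (1 - imag m) • y' - imag m • y,
        sub_mem_lattice (add_mem_lattice hx' (smul_mem_lattice hqI hy'))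
          (smul_mem_lattice hiI hy),
        -((1 - imag m) • y) - y',
        sub_mem_lattice (neg_mem_lattice (smul_mem_lattice hqI hy)) hy', ?_, ?_⟩
      · funext b
        simp
        linear_combination (1 + imag m) * (y b + y' b) * hI
      · funext b
        simp
        linear_combination -y b * hI

/-- Pauli operators act trivially on the lattice modulo `1 + i`. -/
theorem IsPauli.exists_mulVec_sub (hm : 2 ≤ m) {P : Matrix (Bits n) (Bits n) (E m)}
    (hP : IsPauli P) {ψ : Bits n → E m} (hψ : ψ ∈ lattice m n) :
    ∃ z ∈ lattice m n, P.mulVec ψ - ψ = (1 + imag m) • z := by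
  obtain ⟨M, hM, rfl | rfl⟩ := hP
  · exact exists_tensor_mulVec_sub hm M hM hψ
  · obtain ⟨z, hz, e⟩ := exists_tensor_mulVec_sub hm M hM hψ
    refine ⟨-z - (1 - imag m) • ψ, sub_mem_lattice (neg_mem_lattice hz)
      (smul_mem_lattice (isIntegral_one_sub_imag m) hψ), ?_⟩
    rw [Matrix.neg_mulVec, smul_sub, smul_neg, ← e, smul_smul, ← ofNat_two_eq hm, two_smul]
    abel

end Lattice

/-! ### Tensor products of two by two matrices -/

section Tensor

variable {m n : ℕ}

theorem tensor_mul_tensor (M N : Fin n → Matrix (Fin 2) (Fin 2) (E m)) :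
    tensor M * tensor N = tensor fun k => M k * N k := by
  ext a c
  simp only [tensor, Matrix.mul_apply, Matrix.of_apply, Finset.prod_univ_sum,
    Fintype.piFinset_univ, Finset.prod_mul_distrib]

theorem tensor_smul (c : Fin n → E m) (M : Fin n → Matrix (Fin 2) (Fin 2) (E m)) :
    (tensor fun k => c k • M k) = (∏ k, c k) • tensor M := by
  ext a b
  simp only [tensor, Matrix.of_apply, Matrix.smul_apply, smul_eq_mul, Finset.prod_mul_distrib]

theorem tensor_conjTranspose (M : Fin n → Matrix (Fin 2) (Fin 2) (E m)) :
    (tensor M).conjTranspose = tensor fun k => (M k).conjTranspose := by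
  ext a b
  simp only [tensor, Matrix.conjTranspose_apply, Matrix.of_apply]
  exact congrArg _ (map_prod (starRingEnd (E m)) _ _)

theorem tensor_diagonal (d : Fin n → Fin 2 → E m) :
    (tensor fun k => Matrix.diagonal (d k)) =
      Matrix.diagonal fun a : Bits n => ∏ k, d k (a k) := by
  refine Matrix.ext fun a b => ?_
  simp only [tensor, Matrix.of_apply]
  by_cases h : a = b
  · subst h
    simp
  · obtain ⟨k, hk⟩ := Function.ne_iff.1 h
    rw [Matrix.diagonal_apply_ne _ h]
    exact Finset.prod_eq_zero (f := fun k => Matrix.diagonal (d k) (a k) (b k))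
      (Finset.mem_univ k) (Matrix.diagonal_apply_ne (d k) hk)

theorem tensor_one : (tensor fun _ : Fin n => (1 : Matrix (Fin 2) (Fin 2) (E m))) = 1 := by
  simp only [← Matrix.diagonal_one]
  rw [tensor_diagonal]
  simp

end Tensor

/-! ### Pauli operators -/

section Pauli

variable {m n : ℕ}

/-- The Pauli matrix `X`. -/
abbrev pauliX (m : ℕ) : Matrix (Fin 2) (Fin 2) (E m) := !![0, 1; 1, 0]

/-- The Pauli matrix `Y`. -/
abbrev pauliY (m : ℕ) : Matrix (Fin 2) (Fin 2) (E m) := !![0, -imag m; imag m, 0]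

/-- The Pauli matrix `Z`. -/
abbrev pauliZ (m : ℕ) : Matrix (Fin 2) (Fin 2) (E m) := !![1, 0; 0, -1]

theorem one_mem_pauliMatrices (m : ℕ) : 1 ∈ pauliMatrices m := Or.inl rfl

theorem pauliX_mem (m : ℕ) : pauliX m ∈ pauliMatrices m := Or.inr (Or.inl rfl)

theorem pauliY_mem (m : ℕ) : pauliY m ∈ pauliMatrices m := Or.inr (Or.inr (Or.inl rfl))

theorem pauliZ_mem (m : ℕ) : pauliZ m ∈ pauliMatrices m := Or.inr (Or.inr (Or.inr rfl))

theorem conjTranspose_of_mem_pauliMatrices (hm : 2 ≤ m) {M : Matrix (Fin 2) (Fin 2) (E m)}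
    (hM : M ∈ pauliMatrices m) : M.conjTranspose = M := by
  rcases hM with rfl | rfl | rfl | rfl
  · exact Matrix.conjTranspose_one
  all_goals
    refine Matrix.ext fun a b => ?_
    fin_cases a <;> fin_cases b <;> simp [Matrix.conjTranspose_apply, star_imag hm]

theorem mul_self_of_mem_pauliMatrices (hm : 2 ≤ m) {M : Matrix (Fin 2) (Fin 2) (E m)}
    (hM : M ∈ pauliMatrices m) : M * M = 1 := by
  rcases hM with rfl | rfl | rfl | rfl
  · exact one_mul 1
  all_goals simp [imag_mul_self hm, Matrix.one_fin_two]

theorem exists_mul_of_mem_pauliMatrices (hm : 2 ≤ m) {M N : Matrix (Fin 2) (Fin 2) (E m)}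
    (hM : M ∈ pauliMatrices m) (hN : N ∈ pauliMatrices m) :
    ∃ c : E m, c ^ 4 = 1 ∧ ∃ R ∈ pauliMatrices m, M * N = c • R := by
  have hI := imag_mul_self hm
  have h1 : (1 : E m) ^ 4 = 1 := one_pow 4
  have hi : imag m ^ 4 = 1 := by linear_combination (imag m ^ 2 - 1) * hI
  have hj : (-imag m) ^ 4 = 1 := by linear_combination (imag m ^ 2 - 1) * hI
  by_cases hMN : M = N
  · subst hMN
    exact ⟨1, h1, 1, one_mem_pauliMatrices m, by
      rw [mul_self_of_mem_pauliMatrices hm hM, one_smul]⟩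
  rcases hM with rfl | rfl | rfl | rfl
  · exact ⟨1, h1, N, hN, by rw [one_mul, one_smul]⟩
  all_goals rcases hN with rfl | rfl | rfl | rfl
  · exact ⟨1, h1, _, pauliX_mem m, by rw [mul_one, one_smul]⟩
  · exact absurd rfl hMN
  · exact ⟨imag m, hi, _, pauliZ_mem m, by simp⟩
  · exact ⟨-imag m, hj, _, pauliY_mem m, by simp [hI]⟩
  · exact ⟨1, h1, _, pauliY_mem m, by rw [mul_one, one_smul]⟩
  · exact ⟨-imag m, hj, _, pauliZ_mem m, by simp⟩
  · exact absurd rfl hMN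
  · exact ⟨imag m, hi, _, pauliX_mem m, by simp⟩
  · exact ⟨1, h1, _, pauliZ_mem m, by rw [mul_one, one_smul]⟩
  · exact ⟨imag m, hi, _, pauliY_mem m, by simp [hI]⟩
  · exact ⟨-imag m, hj, _, pauliX_mem m, by simp⟩
  · exact absurd rfl hMN

theorem eq_of_pow_four_eq_one (hm : 2 ≤ m) {c : E m} (hc : c ^ 4 = 1) :
    c = 1 ∨ c = -1 ∨ c = imag m ∨ c = -imag m := by
  have hI := imag_mul_self hm
  have h : (c - 1) * ((c + 1) * ((c - imag m) * (c + imag m))) = 0 := by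
    linear_combination hc - (c ^ 2 - 1) * hI
  rcases mul_eq_zero.1 h with h | h
  · exact Or.inl (sub_eq_zero.1 h)
  rcases mul_eq_zero.1 h with h | h
  · exact Or.inr (Or.inl (eq_neg_of_add_eq_zero_left h))
  rcases mul_eq_zero.1 h with h | h
  · exact Or.inr (Or.inr (Or.inl (sub_eq_zero.1 h)))
  · exact Or.inr (Or.inr (Or.inr (eq_neg_of_add_eq_zero_left h)))

theorem IsPauli.neg {P : Matrix (Bits n) (Bits n) (E m)} (hP : IsPauli P) : IsPauli (-P) := by
  obtain ⟨M, hM, rfl | rfl⟩ := hP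
  · exact ⟨M, hM, Or.inr rfl⟩
  · exact ⟨M, hM, Or.inl (neg_neg _)⟩

theorem IsPauli.conjTranspose (hm : 2 ≤ m) {P : Matrix (Bits n) (Bits n) (E m)}
    (hP : IsPauli P) : P.conjTranspose = P := by
  have h : ∀ M : Fin n → Matrix (Fin 2) (Fin 2) (E m), (∀ k, M k ∈ pauliMatrices m) →
      (tensor M).conjTranspose = tensor M := fun M hM => by
    rw [tensor_conjTranspose]
    exact congrArg tensor (funext fun k => conjTranspose_of_mem_pauliMatrices hm (hM k))
  obtain ⟨M, hM, rfl | rfl⟩ := hP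
  · exact h M hM
  · rw [Matrix.conjTranspose_neg, h M hM]

theorem IsPauli.mul_self (hm : 2 ≤ m) {P : Matrix (Bits n) (Bits n) (E m)}
    (hP : IsPauli P) : P * P = 1 := by
  have h : ∀ M : Fin n → Matrix (Fin 2) (Fin 2) (E m), (∀ k, M k ∈ pauliMatrices m) →
      tensor M * tensor M = 1 := fun M hM => by
    rw [tensor_mul_tensor, ← tensor_one]
    exact congrArg tensor (funext fun k => mul_self_of_mem_pauliMatrices hm (hM k))
  obtain ⟨M, hM, rfl | rfl⟩ := hP
  · exact h M hM
  · rw [neg_mul_neg, h M hM]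

theorem IsPauli.exists_mul (hm : 2 ≤ m) {P Q : Matrix (Bits n) (Bits n) (E m)}
    (hP : IsPauli P) (hQ : IsPauli Q) :
    ∃ c : E m, c ^ 4 = 1 ∧ ∃ R, IsPauli R ∧ P * Q = c • R := by
  obtain ⟨M, hM, hPM⟩ := hP
  obtain ⟨N, hN, hQN⟩ := hQ
  choose c hc R hR h using fun k => exists_mul_of_mem_pauliMatrices hm (hM k) (hN k)
  have hT : tensor M * tensor N = (∏ k, c k) • tensor R := by
    rw [tensor_mul_tensor, ← tensor_smul]
    exact congrArg tensor (funext h)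
  have hp : (∏ k, c k) ^ 4 = 1 := by
    rw [← Finset.prod_pow]
    exact Finset.prod_eq_one fun k _ => hc k
  rcases hPM with rfl | rfl <;> rcases hQN with rfl | rfl
  · exact ⟨_, hp, tensor R, ⟨R, hR, Or.inl rfl⟩, hT⟩
  · exact ⟨_, hp, -tensor R, ⟨R, hR, Or.inr rfl⟩, by rw [mul_neg, hT, smul_neg]⟩
  · exact ⟨_, hp, -tensor R, ⟨R, hR, Or.inr rfl⟩, by rw [neg_mul, hT, smul_neg]⟩
  · exact ⟨_, hp, tensor R, ⟨R, hR, Or.inl rfl⟩, by rw [neg_mul_neg, hT]⟩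

/-- Two Pauli operators either commute, or they anticommute and `i` times their product is a
Pauli operator. -/
theorem IsPauli.commute_or (hm : 2 ≤ m) {P Q : Matrix (Bits n) (Bits n) (E m)}
    (hP : IsPauli P) (hQ : IsPauli Q) :
    P * Q = Q * P ∨ (P * Q = -(Q * P) ∧ IsPauli (imag m • (Q * P))) := by
  have hI := imag_mul_self hm
  obtain ⟨c, hc, R, hR, h⟩ := hQ.exists_mul hm hP
  -- Pauli operators are Hermitian, so `P * Q` is the adjoint of `Q * P` and has the conjugate
  -- phase: equal for `c = ±1`, opposite for `c = ±i`.
  have h' : P * Q = star c • R := by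
    have e := congrArg Matrix.conjTranspose h
    rwa [Matrix.conjTranspose_mul, Matrix.conjTranspose_smul, hP.conjTranspose hm,
      hQ.conjTranspose hm, hR.conjTranspose hm] at e
  rw [h, h']
  rcases eq_of_pow_four_eq_one hm hc with rfl | rfl | rfl | rfl
  · left; rw [star_one]
  · left; rw [star_neg, star_one]
  · right
    rw [star_imag hm, neg_smul, smul_smul, hI, neg_smul, one_smul]
    exact ⟨rfl, hR.neg⟩
  · right
    rw [star_neg, star_imag hm, neg_neg, neg_smul, neg_neg, smul_neg, smul_smul, hI, neg_smul,
      one_smul, neg_neg]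
    exact ⟨rfl, hR⟩

end Pauli

/-! ### The Clifford group -/

section Clifford

variable {m n : ℕ}

/-- The unitaries `(1 + i) / 2 + (1 - i) / 2 * P`. -/
theorem cliffordGenerator_mem_unitaryGroup (hm : 2 ≤ m) {P : Matrix (Bits n) (Bits n) (E m)}
    (hP : IsPauli P) :
    ((1 + imag m) / 2) • (1 : Matrix (Bits n) (Bits n) (E m)) + ((1 - imag m) / 2) • P ∈
      Matrix.unitaryGroup (Bits n) (E m) := by
  have hI := imag_mul_self hm
  rw [Matrix.mem_unitaryGroup_iff, Matrix.star_eq_conjTranspose, Matrix.conjTranspose_add,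
    Matrix.conjTranspose_smul, Matrix.conjTranspose_smul, hP.conjTranspose hm,
    Matrix.conjTranspose_one]
  simp only [add_mul, mul_add, smul_mul_assoc, mul_smul_comm, one_mul, mul_one, hP.mul_self hm,
    star_div₀, star_add, star_sub, star_one, star_imag hm, star_ofNat, smul_add, smul_smul]
  match_scalars
  · linear_combination -(1 / 2) * hI
  · linear_combination (1 / 2) * hI

/-- The property of being one of the generators of the Clifford group that is attached to `P`. -/
def IsCliffordGenerator (U : Matrix.unitaryGroup (Bits n) (E m))
    (P : Matrix (Bits n) (Bits n) (E m)) : Prop :=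
  IsPauli P ∧ (U : Matrix (Bits n) (Bits n) (E m)) =
    ((1 + imag m) / 2) • (1 : Matrix (Bits n) (Bits n) (E m)) + ((1 - imag m) / 2) • P

namespace IsCliffordGenerator

variable {U : Matrix.unitaryGroup (Bits n) (E m)} {P : Matrix (Bits n) (Bits n) (E m)}

theorem mem (h : IsCliffordGenerator U P) : U ∈ cliffordGroup m n :=
  Subgroup.subset_closure ⟨P, h⟩

theorem coe_inv (hm : 2 ≤ m) (h : IsCliffordGenerator U P) :
    ((U⁻¹ : Matrix.unitaryGroup (Bits n) (E m)) : Matrix (Bits n) (Bits n) (E m)) =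
      ((1 - imag m) / 2) • (1 : Matrix (Bits n) (Bits n) (E m)) + ((1 + imag m) / 2) • P := by
  change star (U : Matrix (Bits n) (Bits n) (E m)) = _
  rw [h.2, Matrix.star_eq_conjTranspose, Matrix.conjTranspose_add,
    Matrix.conjTranspose_smul, Matrix.conjTranspose_smul, h.1.conjTranspose hm,
    Matrix.conjTranspose_one]
  simp only [star_div₀, star_add, star_sub, star_one, star_imag hm, star_ofNat, sub_neg_eq_add,
    ← sub_eq_add_neg]

theorem mulVec (h : IsCliffordGenerator U P) (ψ : Bits n → E m) :
    (U : Matrix (Bits n) (Bits n) (E m)).mulVec ψ =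
      ((1 + imag m) / 2) • ψ + ((1 - imag m) / 2) • P.mulVec ψ := by
  rw [h.2, Matrix.add_mulVec, Matrix.smul_mulVec, Matrix.smul_mulVec, Matrix.one_mulVec]

theorem inv_mulVec (hm : 2 ≤ m) (h : IsCliffordGenerator U P) (ψ : Bits n → E m) :
    ((U⁻¹ : Matrix.unitaryGroup (Bits n) (E m)) : Matrix (Bits n) (Bits n) (E m)).mulVec ψ =
      ((1 - imag m) / 2) • ψ + ((1 + imag m) / 2) • P.mulVec ψ := by
  rw [h.coe_inv hm, Matrix.add_mulVec, Matrix.smul_mulVec, Matrix.smul_mulVec, Matrix.one_mulVec]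

end IsCliffordGenerator

theorem exists_isCliffordGenerator (hm : 2 ≤ m) {P : Matrix (Bits n) (Bits n) (E m)}
    (hP : IsPauli P) : ∃ U, IsCliffordGenerator U P :=
  ⟨⟨_, cliffordGenerator_mem_unitaryGroup hm hP⟩, hP, rfl⟩

theorem cliffordGroup_induction {p : Matrix.unitaryGroup (Bits n) (E m) → Prop}
    (hgen : ∀ U P, IsCliffordGenerator U P → p U) (hone : p 1)
    (hmul : ∀ U V, p U → p V → p (U * V)) (hinv : ∀ U, p U → p U⁻¹)
    {C : Matrix.unitaryGroup (Bits n) (E m)} (hC : C ∈ cliffordGroup m n) : p C :=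
  Subgroup.closure_induction (p := fun C _ => p C) (fun U hU => hU.elim fun P hP => hgen U P hP) hone
    (fun U V _ _ => hmul U V) (fun U _ => hinv U) hC

theorem mul_mulVec (U V : Matrix.unitaryGroup (Bits n) (E m)) (ψ : Bits n → E m) :
    ((U * V : Matrix.unitaryGroup (Bits n) (E m)) : Matrix (Bits n) (Bits n) (E m)).mulVec ψ =
      (U : Matrix (Bits n) (Bits n) (E m)).mulVec
        ((V : Matrix (Bits n) (Bits n) (E m)).mulVec ψ) :=
  (Matrix.mulVec_mulVec _ _ _).symm

theorem one_unitary_mulVec (ψ : Bits n → E m) :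
    ((1 : Matrix.unitaryGroup (Bits n) (E m)) : Matrix (Bits n) (Bits n) (E m)).mulVec ψ = ψ :=
  Matrix.one_mulVec ψ

theorem inv_mulVec_mulVec (U : Matrix.unitaryGroup (Bits n) (E m)) (ψ : Bits n → E m) :
    ((U⁻¹ : Matrix.unitaryGroup (Bits n) (E m)) : Matrix (Bits n) (Bits n) (E m)).mulVec
      ((U : Matrix (Bits n) (Bits n) (E m)).mulVec ψ) = ψ := by
  rw [← mul_mulVec, inv_mul_cancel, one_unitary_mulVec]

theorem mulVec_inv_mulVec (U : Matrix.unitaryGroup (Bits n) (E m)) (ψ : Bits n → E m) :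
    (U : Matrix (Bits n) (Bits n) (E m)).mulVec
      (((U⁻¹ : Matrix.unitaryGroup (Bits n) (E m)) : Matrix (Bits n) (Bits n) (E m)).mulVec ψ)
        = ψ := by
  rw [← mul_mulVec, mul_inv_cancel, one_unitary_mulVec]

/-- The Clifford group preserves the Barnes-Wall lattice. -/
theorem mulVec_mem_lattice (hm : 2 ≤ m) {C : Matrix.unitaryGroup (Bits n) (E m)}
    (hC : C ∈ cliffordGroup m n) {ψ : Bits n → E m} (hψ : ψ ∈ lattice m n) :
    (C : Matrix (Bits n) (Bits n) (E m)).mulVec ψ ∈ lattice m n := by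
  -- The inverse is carried along so that the inverse case of the closure induction is a swap.
  suffices h : (∀ ψ ∈ lattice m n, (C : Matrix (Bits n) (Bits n) (E m)).mulVec ψ ∈ lattice m n) ∧
      ∀ ψ ∈ lattice m n, ((C⁻¹ : Matrix.unitaryGroup (Bits n) (E m)) :
        Matrix (Bits n) (Bits n) (E m)).mulVec ψ ∈ lattice m n from h.1 ψ hψ
  have hI := imag_mul_self hm
  refine cliffordGroup_induction (p := fun C =>
    (∀ ψ ∈ lattice m n, (C : Matrix (Bits n) (Bits n) (E m)).mulVec ψ ∈ lattice m n) ∧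
      ∀ ψ ∈ lattice m n, ((C⁻¹ : Matrix.unitaryGroup (Bits n) (E m)) :
        Matrix (Bits n) (Bits n) (E m)).mulVec ψ ∈ lattice m n) ?_ ?_ ?_ ?_ hC
  · refine fun U P hU => ⟨fun ψ hψ => ?_, fun ψ hψ => ?_⟩
    · obtain ⟨z, hz, e⟩ := hU.1.exists_mulVec_sub hm hψ
      -- `U - 1 = (1 - i)/2 * (P - 1)`, and the factor `1 + i` gained from `P - 1` cancels the
      -- denominator.
      have key : (U : Matrix (Bits n) (Bits n) (E m)).mulVec ψ = ψ + z := by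
        rw [hU.mulVec, sub_eq_iff_eq_add.1 e]
        match_scalars
        · ring
        · linear_combination -(1 / 2) * hI
      rw [key]
      exact add_mem_lattice hψ hz
    · obtain ⟨z, hz, e⟩ := hU.1.exists_mulVec_sub hm hψ
      have key : ((U⁻¹ : Matrix.unitaryGroup (Bits n) (E m)) :
          Matrix (Bits n) (Bits n) (E m)).mulVec ψ = ψ + imag m • z := by
        rw [hU.inv_mulVec hm, sub_eq_iff_eq_add.1 e]
        match_scalars
        · ring
        · linear_combination (1 / 2) * hI
      rw [key]
      exact add_mem_lattice hψ (smul_mem_lattice (isIntegral_imag m) hz)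
  · simp only [inv_one, one_unitary_mulVec]
    exact ⟨fun _ h => h, fun _ h => h⟩
  · rintro U V ⟨h1, h2⟩ ⟨h3, h4⟩
    simp only [mul_inv_rev, mul_mulVec]
    exact ⟨fun ψ hψ => h1 _ (h3 ψ hψ), fun ψ hψ => h4 _ (h2 ψ hψ)⟩
  · rintro U ⟨h1, h2⟩
    rw [inv_inv]
    exact ⟨h2, h1⟩

/-- The coefficients are left free so that one computation covers conjugation by `U` and by `U⁻¹`.
-/
theorem conj_of_anticommute {P Q : Matrix (Bits n) (Bits n) (E m)} (hP : P * P = 1)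
    (h : P * Q = -(Q * P)) (a b c d : E m) :
    (a • (1 : Matrix (Bits n) (Bits n) (E m)) + b • P) * Q * (c • 1 + d • P) =
      (a * c - b * d) • Q + (a * d - b * c) • (Q * P) := by
  have h2 : Q * P * P = Q := by rw [mul_assoc, hP, mul_one]
  simp only [add_mul, mul_add, smul_mul_assoc, mul_smul_comm, one_mul, mul_one, h, neg_mul,
    h2, smul_neg]
  module

/-- The Clifford group normalizes the Pauli operators. -/
theorem IsPauli.conj (hm : 2 ≤ m) {C : Matrix.unitaryGroup (Bits n) (E m)}
    (hC : C ∈ cliffordGroup m n) {Q : Matrix (Bits n) (Bits n) (E m)} (hQ : IsPauli Q) :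
    IsPauli ((C : Matrix (Bits n) (Bits n) (E m)) * Q *
      ((C⁻¹ : Matrix.unitaryGroup (Bits n) (E m)) : Matrix (Bits n) (Bits n) (E m))) := by
  have hI := imag_mul_self hm
  have hcoe : ∀ U V : Matrix.unitaryGroup (Bits n) (E m),
      ((U * V : Matrix.unitaryGroup (Bits n) (E m)) : Matrix (Bits n) (Bits n) (E m)) =
        (U : Matrix (Bits n) (Bits n) (E m)) * V := fun _ _ => rfl
  suffices h : ∀ Q : Matrix (Bits n) (Bits n) (E m), IsPauli Q →
      IsPauli ((C : Matrix (Bits n) (Bits n) (E m)) * Q *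
        ((C⁻¹ : Matrix.unitaryGroup (Bits n) (E m)) : Matrix (Bits n) (Bits n) (E m))) ∧
      IsPauli (((C⁻¹ : Matrix.unitaryGroup (Bits n) (E m)) : Matrix (Bits n) (Bits n) (E m)) *
        Q * (C : Matrix (Bits n) (Bits n) (E m))) from (h Q hQ).1
  refine cliffordGroup_induction (p := fun C => ∀ Q : Matrix (Bits n) (Bits n) (E m), IsPauli Q →
      IsPauli ((C : Matrix (Bits n) (Bits n) (E m)) * Q *
        ((C⁻¹ : Matrix.unitaryGroup (Bits n) (E m)) : Matrix (Bits n) (Bits n) (E m))) ∧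
      IsPauli (((C⁻¹ : Matrix.unitaryGroup (Bits n) (E m)) : Matrix (Bits n) (Bits n) (E m)) *
        Q * (C : Matrix (Bits n) (Bits n) (E m)))) ?_ ?_ ?_ ?_ hC
  · intro U P hU Q hQ
    rcases hU.1.commute_or hm hQ with h | ⟨h, hR⟩
    · have hc : (U : Matrix (Bits n) (Bits n) (E m)) * Q = Q * U := by
        rw [hU.2, add_mul, mul_add, smul_mul_assoc, smul_mul_assoc, mul_smul_comm, mul_smul_comm,
          h, one_mul, mul_one]
      have h1 : (U : Matrix (Bits n) (Bits n) (E m)) *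
          ((U⁻¹ : Matrix.unitaryGroup (Bits n) (E m)) : Matrix (Bits n) (Bits n) (E m)) = 1 := by
        rw [← hcoe, mul_inv_cancel]; rfl
      have h2 : ((U⁻¹ : Matrix.unitaryGroup (Bits n) (E m)) : Matrix (Bits n) (Bits n) (E m)) *
          (U : Matrix (Bits n) (Bits n) (E m)) = 1 := by
        rw [← hcoe, inv_mul_cancel]; rfl
      rw [hc, mul_assoc, h1, mul_assoc, ← hc, ← mul_assoc, h2, mul_one, one_mul]
      exact ⟨hQ, hQ⟩
    · rw [hU.coe_inv hm, hU.2, conj_of_anticommute (hU.1.mul_self hm) h,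
        conj_of_anticommute (hU.1.mul_self hm) h]
      -- The coefficient of `Q` cancels and `±i Q P` remains, a Pauli operator by
      -- `IsPauli.commute_or`.
      have e1 : (1 + imag m) / 2 * ((1 - imag m) / 2) - (1 - imag m) / 2 * ((1 + imag m) / 2) = 0 :=
        by ring
      have e2 : (1 + imag m) / 2 * ((1 + imag m) / 2) - (1 - imag m) / 2 * ((1 - imag m) / 2) =
        imag m := by ring
      have e3 : (1 - imag m) / 2 * ((1 + imag m) / 2) - (1 + imag m) / 2 * ((1 - imag m) / 2) = 0 :=
        by ring
      have e4 : (1 - imag m) / 2 * ((1 - imag m) / 2) - (1 + imag m) / 2 * ((1 + imag m) / 2) =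
        -imag m := by ring
      rw [e1, e2, e3, e4, zero_smul, zero_add, zero_add, neg_smul]
      exact ⟨hR, hR.neg⟩
  · intro Q hQ
    rw [inv_one]
    change IsPauli (1 * Q * 1) ∧ IsPauli (1 * Q * 1)
    rw [one_mul, mul_one]
    exact ⟨hQ, hQ⟩
  · intro U V h1 h2 Q hQ
    constructor
    · have := (h1 _ (h2 Q hQ).1).1
      simpa only [mul_inv_rev, hcoe, mul_assoc] using this
    · have := (h2 _ (h1 Q hQ).2).2
      simpa only [mul_inv_rev, hcoe, mul_assoc] using this
  · intro U h Q hQ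
    rw [inv_inv]
    exact ⟨(h Q hQ).2, (h Q hQ).1⟩

/-- The generator attached to `P` is a square root of `P`. -/
theorem IsPauli.mem_cliffordGroup (hm : 2 ≤ m) {P : Matrix (Bits n) (Bits n) (E m)}
    (hP : IsPauli P) : ∃ C ∈ cliffordGroup m n, ∀ ψ : Bits n → E m,
      (C : Matrix (Bits n) (Bits n) (E m)).mulVec ψ = P.mulVec ψ := by
  have hI := imag_mul_self hm
  obtain ⟨U, hU⟩ := exists_isCliffordGenerator hm hP
  refine ⟨U * U, mul_mem hU.mem hU.mem, fun ψ => ?_⟩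
  rw [mul_mulVec, hU.mulVec, hU.mulVec, Matrix.mulVec_add, Matrix.mulVec_smul, Matrix.mulVec_smul,
    Matrix.mulVec_mulVec, hP.mul_self hm, Matrix.one_mulVec]
  match_scalars
  · linear_combination (1 / 2) * hI
  · linear_combination -(1 / 2) * hI

/-- Clifford operators may be extended by the identity on a further qubit. -/
theorem exists_lift_cliffordGroup (hm : 2 ≤ m) {C : Matrix.unitaryGroup (Bits n) (E m)}
    (hC : C ∈ cliffordGroup m n) :
    ∃ D ∈ cliffordGroup m (n + 1), ∀ (a : Fin 2) (ψ : Bits (n + 1) → E m),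
      half a ((D : Matrix (Bits (n + 1)) (Bits (n + 1)) (E m)).mulVec ψ) =
        (C : Matrix (Bits n) (Bits n) (E m)).mulVec (half a ψ) := by
  refine cliffordGroup_induction (p := fun C =>
    ∃ D ∈ cliffordGroup m (n + 1), ∀ (a : Fin 2) (ψ : Bits (n + 1) → E m),
      half a ((D : Matrix (Bits (n + 1)) (Bits (n + 1)) (E m)).mulVec ψ) =
        (C : Matrix (Bits n) (Bits n) (E m)).mulVec (half a ψ)) ?_ ?_ ?_ ?_ hC
  · intro U P hU
    obtain ⟨P', hP', e⟩ : ∃ P' : Matrix (Bits (n + 1)) (Bits (n + 1)) (E m), IsPauli P' ∧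
        ∀ (a : Fin 2) (ψ : Bits (n + 1) → E m),
          half a (P'.mulVec ψ) = P.mulVec (half a ψ) := by
      have key : ∀ (M : Fin n → Matrix (Fin 2) (Fin 2) (E m)) (a : Fin 2)
          (ψ : Bits (n + 1) → E m),
          half a ((tensor (Fin.cons 1 M : Fin (n + 1) → Matrix (Fin 2) (Fin 2) (E m))).mulVec ψ) =
            (tensor M).mulVec (half a ψ) := fun M a ψ => by
        rw [half_tensor_mulVec]
        fin_cases a <;> simp
      obtain ⟨M, hM, hP⟩ := hU.1
      have hM' : ∀ k, (Fin.cons 1 M : Fin (n + 1) → Matrix (Fin 2) (Fin 2) (E m)) k ∈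
          pauliMatrices m := Fin.cases (one_mem_pauliMatrices m) hM
      rcases hP with rfl | rfl
      · exact ⟨_, ⟨_, hM', Or.inl rfl⟩, key M⟩
      · refine ⟨_, ⟨_, hM', Or.inr rfl⟩, fun a ψ => ?_⟩
        rw [Matrix.neg_mulVec, Matrix.neg_mulVec, ← key]
        rfl
    obtain ⟨D, hD⟩ := exists_isCliffordGenerator hm hP'
    refine ⟨D, hD.mem, fun a ψ => ?_⟩
    rw [hD.mulVec, hU.mulVec, half_add, half_smul, half_smul, e]
  · exact ⟨1, one_mem _, fun a ψ => by rw [one_unitary_mulVec, one_unitary_mulVec]⟩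
  · rintro U V ⟨D, hD, eD⟩ ⟨F, hF, eF⟩
    exact ⟨D * F, mul_mem hD hF, fun a ψ => by rw [mul_mulVec, mul_mulVec, eD, eF]⟩
  · rintro U ⟨D, hD, eD⟩
    refine ⟨D⁻¹, inv_mem hD, fun a ψ => ?_⟩
    rw [← inv_mulVec_mulVec U (half a _), ← eD, mulVec_inv_mulVec]

end Clifford

/-! ### Stabilizer states -/

section Stabilizer

variable {m n : ℕ}

theorem traceNorm_ketZero_smul (hm : 2 ≤ m) :
    traceNorm ((1 + imag m) ^ n • ketZero m n) = (Module.finrank ℚ (E m) : ℚ) / 2 * 2 ^ n := by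
  induction n with
  | zero =>
    have h := two_mul_traceNorm hm ((1 + imag m) ^ 0 • ketZero m 0)
    have e : ∀ b : Bits 0, ((1 + imag m) ^ 0 • ketZero m 0) b = 1 := fun b => by
      simp [ketZero, Subsingleton.elim b 0]
    simp only [e, map_one, norm_one, one_pow, Finset.sum_const, Finset.card_univ,
      card_embeddings] at h
    have h' : 2 * traceNorm ((1 + imag m) ^ 0 • ketZero m 0) = (Module.finrank ℚ (E m) : ℚ) := by
      simp at h
      simp
      exact_mod_cast h
    linarith
  | succ n ih =>
    rw [traceNorm_succ, half_smul, half_smul, half_zero_ketZero, half_one_ketZero, smul_zero,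
      traceNorm_zero, pow_succ', mul_smul, traceNorm_one_add_imag_smul hm, ih]
    ring

/-- The operator `Z` on the `j`-th qubit. -/
def zAt (m : ℕ) {n : ℕ} (j : Fin n) : Matrix (Bits n) (Bits n) (E m) :=
  Matrix.diagonal fun a => if a j = 1 then -1 else 1

theorem isPauli_zAt (j : Fin n) : IsPauli (zAt m j) := by
  refine ⟨fun k => Matrix.diagonal fun a => if k = j then if a = 1 then -1 else 1 else 1,
    fun k => ?_, Or.inl ?_⟩
  · by_cases h : k = j
    · right; right; right
      refine Matrix.ext fun a b => ?_
      fin_cases a <;> fin_cases b <;> simp [h]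
    · left
      simp [h]
  · rw [tensor_diagonal, zAt]
    simp

theorem zAt_mulVec_single (j : Fin n) (b : Bits n) :
    (zAt m j).mulVec (Pi.single b 1) =
      if b j = 1 then -(Pi.single b 1 : Bits n → E m) else Pi.single b 1 := by
  funext a
  rw [zAt, Matrix.mulVec_diagonal]
  by_cases h : a = b
  · subst h
    split_ifs <;> simp
  · split_ifs <;> simp [h]

/-- The stabilizers are the conjugates by `C` of the operators `Z` on the single qubits, which fix
`|0⟩`. -/
theorem isStabilizerState_of_clifford (hm : 2 ≤ m) {C : Matrix.unitaryGroup (Bits n) (E m)}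
    (hC : C ∈ cliffordGroup m n) {c : E m} (hc : c ≠ 0) :
    IsStabilizerState (c • (C : Matrix (Bits n) (Bits n) (E m)).mulVec (ketZero m n)) := by
  have hcoe : ((C⁻¹ : Matrix.unitaryGroup (Bits n) (E m)) : Matrix (Bits n) (Bits n) (E m)) * C =
      1 := Matrix.UnitaryGroup.star_mul_self C
  have hinj : ∀ φ ψ : Bits n → E m, (C : Matrix (Bits n) (Bits n) (E m)).mulVec φ =
      (C : Matrix (Bits n) (Bits n) (E m)).mulVec ψ → φ = ψ := fun φ ψ h => by
    rw [← inv_mulVec_mulVec C φ, h, inv_mulVec_mulVec]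
  have hact : ∀ (Q : Matrix (Bits n) (Bits n) (E m)) (ψ : Bits n → E m),
      ((C : Matrix (Bits n) (Bits n) (E m)) * Q *
        ((C⁻¹ : Matrix.unitaryGroup (Bits n) (E m)) : Matrix (Bits n) (Bits n) (E m))).mulVec
          ((C : Matrix (Bits n) (Bits n) (E m)).mulVec ψ) =
        (C : Matrix (Bits n) (Bits n) (E m)).mulVec (Q.mulVec ψ) := fun Q ψ => by
    rw [Matrix.mulVec_mulVec, mul_assoc, hcoe, mul_one, Matrix.mulVec_mulVec]
  refine ⟨?_, fun j => (C : Matrix (Bits n) (Bits n) (E m)) * zAt m j *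
    ((C⁻¹ : Matrix.unitaryGroup (Bits n) (E m)) : Matrix (Bits n) (Bits n) (E m)),
    fun j => (isPauli_zAt j).conj hm hC, fun j k => ?_, fun j hj => ?_, fun j => ?_⟩
  · refine smul_ne_zero hc fun h => ?_
    have h0 := congrFun (hinj _ 0 (by rw [h, Matrix.mulVec_zero])) 0
    simp [ketZero] at h0
  · have hz : zAt m j * zAt m k = zAt m k * zAt m j := by
      simp only [zAt, Matrix.diagonal_mul_diagonal, mul_comm]
    change _ * _ = _ * _
    simp only [mul_assoc]
    rw [← mul_assoc _ (C : Matrix (Bits n) (Bits n) (E m)),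
      ← mul_assoc _ (C : Matrix (Bits n) (Bits n) (E m)), hcoe, one_mul, one_mul,
      ← mul_assoc (zAt m j), ← mul_assoc (zAt m k), hz]
  · let e : Bits n → E m := Pi.single (Pi.single j 1 : Bits n) 1
    have hfix : ∀ A ∈ Submonoid.closure ((fun j => (C : Matrix (Bits n) (Bits n) (E m)) *
        zAt m j * ((C⁻¹ : Matrix.unitaryGroup (Bits n) (E m)) :
          Matrix (Bits n) (Bits n) (E m))) '' {k | k ≠ j}),
        A.mulVec ((C : Matrix (Bits n) (Bits n) (E m)).mulVec e) =
          (C : Matrix (Bits n) (Bits n) (E m)).mulVec e := by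
      intro A hA
      induction hA using Submonoid.closure_induction with
      | mem A hA =>
        obtain ⟨k, hk, rfl⟩ := hA
        rw [hact, zAt_mulVec_single, if_neg (by simp [Pi.single_eq_of_ne hk])]
      | one => rw [Matrix.one_mulVec]
      | mul A B _ _ hA hB => rw [← Matrix.mulVec_mulVec, hB, hA]
    have h1 := hfix _ hj
    rw [hact, zAt_mulVec_single, if_pos (by simp)] at h1
    have h2 := congrFun (hinj _ _ h1) (Pi.single j 1)
    simp only [e, Pi.neg_apply, Pi.single_eq_same] at h2
    exact one_ne_zero (self_eq_neg.1 h2.symm)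
  · rw [Matrix.mulVec_smul, hact, ketZero, zAt_mulVec_single, if_neg (by simp)]

end Stabilizer

/-! ### Minimal vectors -/

section Minimal

variable {m n : ℕ}

theorem two_mul_traceNorm_bits_zero (hm : 2 ≤ m) (ψ : Bits 0 → E m) :
    2 * (traceNorm ψ : ℝ) = ∑ σ : E m →ₐ[ℚ] ℂ, ‖σ (ψ 0)‖ ^ 2 := by
  rw [two_mul_traceNorm hm, Fintype.sum_subsingleton _ (0 : Bits 0)]

theorem le_traceNorm (hm : 2 ≤ m) {ψ : Bits n → E m} (hψ : ψ ∈ lattice m n) (h0 : ψ ≠ 0) :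
    (Module.finrank ℚ (E m) : ℚ) / 2 * 2 ^ n ≤ traceNorm ψ := by
  induction n with
  | zero =>
    have hx : ψ 0 ≠ 0 := fun h => h0 (funext fun b => by rw [Subsingleton.elim b 0, h]; rfl)
    have h := (finrank_le_sum_embeddings (mem_lattice_zero.1 hψ) hx).1
    rw [← two_mul_traceNorm_bits_zero hm] at h
    have h' : (Module.finrank ℚ (E m) : ℚ) ≤ 2 * traceNorm ψ := by exact_mod_cast h
    linarith
  | succ n ih =>
    obtain ⟨x, hx, y, hy, e0, e1⟩ := mem_lattice_succ.1 hψ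
    rw [traceNorm_succ, pow_succ, e0, e1]
    by_cases hy0 : y = 0
    · subst hy0
      have hx0 : x ≠ 0 := by
        rintro rfl
        exact h0 (half_ext (by rw [e0, smul_zero, add_zero]; rfl) (by rw [e1]; rfl))
      rw [add_zero, traceNorm_zero, traceNorm_one_add_imag_smul hm]
      linarith [ih hx hx0]
    · by_cases hs : (1 + imag m) • x + y = 0
      · have hyx : y = (1 + imag m) • -x := by
          rw [smul_neg]; exact eq_neg_of_add_eq_zero_right hs
        have hx0 : -x ≠ 0 := fun h => hy0 (by rw [hyx, h, smul_zero])
        rw [hs, traceNorm_zero, hyx, traceNorm_one_add_imag_smul hm]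
        linarith [ih (neg_mem_lattice hx) hx0]
      · linarith [ih hy hy0, ih (add_mem_lattice
          (smul_mem_lattice (isIntegral_one_add_imag m) hx) hy) hs]

theorem isMinimum_lattice (hm : 2 ≤ m) :
    IsMinimum (lattice m n) ((Module.finrank ℚ (E m) : ℚ) / 2 * 2 ^ n) := by
  refine ⟨⟨_, ketZero_smul_mem_lattice m n, ?_, traceNorm_ketZero_smul hm⟩, ?_⟩
  · refine smul_ne_zero (pow_ne_zero _ (one_add_imag_ne_zero hm)) fun h => ?_
    have := congrFun h 0
    simp [ketZero] at this
  · rintro _ ⟨ψ, hψ, h0, rfl⟩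
    exact le_traceNorm hm hψ h0

theorem minimum_pos (m n : ℕ) : 0 < (Module.finrank ℚ (E m) : ℚ) / 2 * 2 ^ n := by
  have : 0 < Module.finrank ℚ (E m) := Module.finrank_pos
  positivity

/-- The minimal vectors that are congruent to `(1 + i) ^ n |0⟩` modulo `1 + i` are multiples of
standard basis vectors. -/
theorem eq_single_of_congr_ketZero (hm : 2 ≤ m) {y z : Bits n → E m}
    (hy : traceNorm y = (Module.finrank ℚ (E m) : ℚ) / 2 * 2 ^ n)
    (hz : z ∈ lattice m n) (hyz : y - (1 + imag m) ^ n • ketZero m n = (1 + imag m) • z) :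
    ∃ (c : E m) (b : Bits n), c ^ 4 = 1 ∧ y = (c * (1 + imag m) ^ n) • Pi.single b 1 := by
  induction n with
  | zero =>
    have hz0 := mem_lattice_zero.1 hz
    have e : y 0 - 1 = (1 + imag m) * z 0 := by
      have := congrFun hyz 0
      simpa [ketZero] using this
    have hyI : IsIntegral ℤ (y 0) := by
      rw [sub_eq_iff_eq_add.1 e]
      exact ((isIntegral_one_add_imag m).mul hz0).add isIntegral_one
    have hy0 : y 0 ≠ 0 := fun h => by
      have h' : y = 0 := funext fun b => by rw [Subsingleton.elim b 0, h]; rfl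
      rw [h', traceNorm_zero] at hy
      exact (minimum_pos m 0).ne hy
    have hsum : ∑ σ : E m →ₐ[ℚ] ℂ, ‖σ (y 0)‖ ^ 2 = (Module.finrank ℚ (E m) : ℝ) := by
      rw [← two_mul_traceNorm_bits_zero hm, hy]
      push_cast
      ring
    refine ⟨y 0, 0, pow_four_eq_one_of_congr hm
      ((finrank_le_sum_embeddings hyI hy0).2 hsum) hz0 e, ?_⟩
    funext b
    rw [Subsingleton.elim b 0]
    simp
  | succ n ih =>
    have hI := imag_mul_self hm
    obtain ⟨a, ha, z1, hz1, e0, e1⟩ := mem_lattice_succ.1 hz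
    have hπ := isIntegral_one_add_imag m
    set k0 := (1 + imag m) ^ n • ketZero m n with hk0
    have hk0L : k0 ∈ lattice m n := ketZero_smul_mem_lattice m n
    have hk : (1 + imag m) ^ (n + 1) • ketZero m n = (1 + imag m) • k0 := by
      rw [hk0, smul_smul, pow_succ']
    clear_value k0
    have f0 : half 0 y = (1 + imag m) • (k0 + ((1 + imag m) • a + z1)) := by
      have h := congrArg (half 0) hyz
      rw [half_sub, half_smul, half_smul, half_zero_ketZero, e0, hk] at h
      rw [sub_eq_iff_eq_add.1 h]
      module
    have f1 : half 1 y = (1 + imag m) • z1 := by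
      have h := congrArg (half 1) hyz
      rwa [half_sub, half_smul, half_smul, half_one_ketZero, e1, smul_zero, sub_zero] at h
    -- The halves of `y` are `(1 + i) w` and `(1 + i) z1`, so the trace forms of `w` and `z1` add up
    -- to the minimum for `n` qubits. Hence one of the two vanishes and the other is minimal.
    set w := k0 + ((1 + imag m) • a + z1) with hw
    have hwL : w ∈ lattice m n := add_mem_lattice hk0L (add_mem_lattice (smul_mem_lattice hπ ha) hz1)
    rw [traceNorm_succ, f0, f1, traceNorm_one_add_imag_smul hm, traceNorm_one_add_imag_smul hm,
      pow_succ] at hy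
    have hpos := minimum_pos m n
    by_cases hz10 : z1 = 0
    · subst hz10
      rw [traceNorm_zero] at hy
      obtain ⟨c, b, hc, e⟩ := ih (y := w) (by linarith) ha (by rw [hw]; abel)
      refine ⟨c, Fin.cons 0 b, hc, half_ext ?_ ?_⟩
      · rw [f0, half_smul, half_single, if_pos rfl, e, smul_smul]
        congr 1
        ring
      · rw [f1, half_smul, half_single, if_neg (by decide), smul_zero, smul_zero]
    · have hw0 : w = 0 := by
        by_contra hne
        linarith [le_traceNorm hm hz1 hz10, le_traceNorm hm hwL hne]
      rw [hw0, traceNorm_zero] at hy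
      -- Here `z1 = -k0 - (1 + i) a`, which is still congruent to `k0` because `2 = (1 + i)(1 - i)`.
      obtain ⟨c, b, hc, e⟩ := ih (y := z1) (z := -((1 - imag m) • k0) - a) (by linarith)
        (sub_mem_lattice (neg_mem_lattice (smul_mem_lattice (isIntegral_one_sub_imag m) hk0L)) ha)
        (by
          have h1 : z1 = -k0 - (1 + imag m) • a := by
            rw [hw] at hw0
            linear_combination (exp := 1) hw0
          rw [h1]
          match_scalars
          · linear_combination -hI
          · ring)
      refine ⟨c, Fin.cons 1 b, hc, half_ext ?_ ?_⟩
      · rw [f0, half_smul, half_single, if_neg (by decide), hw0, smul_zero, smul_zero]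
      · rw [f1, half_smul, half_single, if_pos rfl, e, smul_smul]
        congr 1
        ring

theorem tensor_pauliX_mulVec_ketZero (b : Bits n) :
    (tensor fun k => if b k = 1 then pauliX m else 1).mulVec (ketZero m n) = Pi.single b 1 := by
  funext a
  rw [ketZero, Matrix.mulVec_single_one]
  change ∏ k, (if b k = 1 then pauliX m else 1) (a k) 0 = _
  have h : ∀ p q : Fin 2, (if q = 1 then pauliX m else 1) p 0 = if p = q then 1 else 0 := by
    intro p q
    fin_cases p <;> fin_cases q <;> simp [Matrix.one_apply]
  simp only [h]
  by_cases hab : a = b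
  · subst hab
    simp
  · obtain ⟨k, hk⟩ := Function.ne_iff.1 hab
    rw [Pi.single_eq_of_ne hab]
    exact Finset.prod_eq_zero (Finset.mem_univ k) (if_neg hk)

/-- On the first qubit `X` gives `|1⟩` and `Y` gives `i |1⟩`, so these and a sign realize all four
phases; `X` on the other qubits produces `b`. -/
theorem exists_isPauli_mulVec_ketZero (hm : 2 ≤ m) {c : E m} (hc : c ^ 4 = 1) (b : Bits n) :
    ∃ P : Matrix (Bits (n + 1)) (Bits (n + 1)) (E m), IsPauli P ∧
      half 0 (P.mulVec (ketZero m (n + 1))) = 0 ∧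
      half 1 (P.mulVec (ketZero m (n + 1))) = c • Pi.single b 1 := by
  let M (t : Matrix (Fin 2) (Fin 2) (E m)) : Fin (n + 1) → Matrix (Fin 2) (Fin 2) (E m) :=
    Fin.cons t fun k => if b k = 1 then pauliX m else 1
  have hM : ∀ t ∈ pauliMatrices m, ∀ k, M t k ∈ pauliMatrices m := fun t ht =>
    Fin.cases ht fun k => by
      change (if b k = 1 then pauliX m else 1) ∈ pauliMatrices m
      split_ifs
      · exact pauliX_mem m
      · exact one_mem_pauliMatrices m
  have key : ∀ t a, half a ((tensor (M t)).mulVec (ketZero m (n + 1))) =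
      t a 0 • (Pi.single b 1 : Bits n → E m) := fun t a => by
    rw [half_tensor_mulVec, half_zero_ketZero, half_one_ketZero, Matrix.mulVec_zero, smul_zero,
      add_zero]
    congr 1
    exact tensor_pauliX_mulVec_ketZero b
  have hneg : ∀ t a, half a ((-tensor (M t)).mulVec (ketZero m (n + 1))) =
      -t a 0 • (Pi.single b 1 : Bits n → E m) := fun t a => by
    rw [Matrix.neg_mulVec, neg_smul, ← key]
    rfl
  rcases eq_of_pow_four_eq_one hm hc with rfl | rfl | rfl | rfl
  · refine ⟨_, ⟨_, hM _ (pauliX_mem m), Or.inl rfl⟩, ?_, ?_⟩ <;> rw [key] <;> simp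
  · refine ⟨_, ⟨_, hM _ (pauliX_mem m), Or.inr rfl⟩, ?_, ?_⟩ <;> rw [hneg] <;> simp
  · refine ⟨_, ⟨_, hM _ (pauliY_mem m), Or.inl rfl⟩, ?_, ?_⟩ <;> rw [key] <;> simp
  · refine ⟨_, ⟨_, hM _ (pauliY_mem m), Or.inr rfl⟩, ?_, ?_⟩ <;> rw [hneg] <;> simp

theorem zeta_pow_mul_star (m k : ℕ) : zeta m ^ k * star (zeta m ^ k) = 1 := by
  rw [star_pow, ← mul_pow, zeta_mul_star, one_pow]

theorem exists_zeta_pow_mul_eq_one (m k : ℕ) : ∃ l, zeta m ^ k * zeta m ^ l = 1 := by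
  refine ⟨(2 ^ m - 1) * k, ?_⟩
  have h : k + (2 ^ m - 1) * k = 2 ^ m * k := by
    obtain ⟨r, hr⟩ := Nat.exists_eq_succ_of_ne_zero (show 2 ^ m ≠ 0 by positivity)
    rw [hr, Nat.succ_sub_one, Nat.succ_mul, add_comm]
  rw [← pow_add, h, pow_mul, zeta_pow_two_pow, one_pow]

/-- The minimal vectors form a single orbit under the Clifford group and roots of unity. -/
theorem exists_clifford_of_traceNorm_eq (hm : 2 ≤ m) {ψ : Bits n → E m} (hψ : ψ ∈ lattice m n)
    (hT : traceNorm ψ = (Module.finrank ℚ (E m) : ℚ) / 2 * 2 ^ n) :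
    ∃ k : ℕ, ∃ C ∈ cliffordGroup m n, ψ = (zeta m ^ k * (1 + imag m) ^ n) •
      (C : Matrix (Bits n) (Bits n) (E m)).mulVec (ketZero m n) := by
  induction n with
  | zero =>
    have hψI := mem_lattice_zero.1 hψ
    have h0 : ψ 0 ≠ 0 := fun h => by
      have h' : ψ = 0 := funext fun b => by rw [Subsingleton.elim b 0, h]; rfl
      rw [h', traceNorm_zero] at hT
      exact (minimum_pos m 0).ne hT
    have hsum : ∑ σ : E m →ₐ[ℚ] ℂ, ‖σ (ψ 0)‖ ^ 2 = (Module.finrank ℚ (E m) : ℝ) := by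
      rw [← two_mul_traceNorm_bits_zero hm, hT]
      push_cast
      ring
    obtain ⟨k, hk⟩ := exists_eq_zeta_pow hm hψI ((finrank_le_sum_embeddings hψI h0).2 hsum)
    refine ⟨k, 1, one_mem _, ?_⟩
    rw [one_unitary_mulVec]
    funext b
    rw [Subsingleton.elim b 0, hk]
    simp [ketZero]
  | succ n ih =>
    have hI := imag_mul_self hm
    have hπ := isIntegral_one_add_imag m
    have hpos := minimum_pos m n
    obtain ⟨x, hx, y, hy, e0, e1⟩ := mem_lattice_succ.1 hψ
    rw [traceNorm_succ, e0, e1, pow_succ] at hT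
    by_cases hy0 : y = 0
    · subst hy0
      rw [add_zero, traceNorm_zero, traceNorm_one_add_imag_smul hm] at hT
      obtain ⟨k, C, hC, e⟩ := ih hx (by linarith)
      obtain ⟨D, hD, eD⟩ := exists_lift_cliffordGroup hm hC
      refine ⟨k, D, hD, half_ext ?_ ?_⟩
      · rw [e0, half_smul, eD, half_zero_ketZero, e, add_zero, smul_smul]
        congr 1
        ring
      · rw [e1, half_smul, eD, half_one_ketZero, Matrix.mulVec_zero, smul_zero]
    by_cases hs : (1 + imag m) • x + y = 0
    · have hyx : y = -((1 + imag m) • x) := eq_neg_of_add_eq_zero_right hs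
      rw [hs, traceNorm_zero, hyx, ← smul_neg, traceNorm_one_add_imag_smul hm] at hT
      obtain ⟨k, C, hC, e⟩ := ih (neg_mem_lattice hx) (by linarith)
      obtain ⟨D, hD, eD⟩ := exists_lift_cliffordGroup hm hC
      -- Only the lower half survives, so the first qubit is flipped before the lifted operator is
      -- applied.
      obtain ⟨P, hP, p0, p1⟩ := exists_isPauli_mulVec_ketZero (n := n) hm (one_pow 4) 0
      obtain ⟨W, hW, eW⟩ := hP.mem_cliffordGroup hm
      refine ⟨k, D * W, mul_mem hD hW, half_ext ?_ ?_⟩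
      · rw [e0, hs, half_smul, mul_mulVec, eD, eW, p0, Matrix.mulVec_zero, smul_zero]
      · rw [e1, half_smul, mul_mulVec, eD, eW, p1, one_smul, hyx, ← smul_neg, e, smul_smul]
        congr 1
        ring
    · have hsL : (1 + imag m) • x + y ∈ lattice m n := add_mem_lattice (smul_mem_lattice hπ hx) hy
      have h1 := le_traceNorm hm hy hy0
      have h2 := le_traceNorm hm hsL hs
      obtain ⟨k, C, hC, e⟩ := ih hsL (by linarith)
      obtain ⟨l, hl⟩ := exists_zeta_pow_mul_eq_one m k
      let C' := ((C⁻¹ : Matrix.unitaryGroup (Bits n) (E m)) : Matrix (Bits n) (Bits n) (E m))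
      have hCinv : C'.mulVec ((1 + imag m) • x + y) =
          (zeta m ^ k * (1 + imag m) ^ n) • ketZero m n := by
        rw [e, Matrix.mulVec_smul, inv_mulVec_mulVec]
      -- Both halves are minimal. Applying `ζ^l C⁻¹` sends the upper one to `(1 + i)^n |0⟩` and
      -- keeps the lower one minimal and congruent to it.
      obtain ⟨c, b, hc, ey⟩ := eq_single_of_congr_ketZero hm (y := zeta m ^ l • C'.mulVec y)
        (z := zeta m ^ l • C'.mulVec (-x))
        (by
          rw [traceNorm_smul_of_unit (zeta_pow_mul_star m l), traceNorm_mulVec_unitary]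
          linarith)
        (smul_mem_lattice ((isIntegral_zeta m).pow l)
          (mulVec_mem_lattice hm (inv_mem hC) (neg_mem_lattice hx)))
        (by
          have h3 : (1 + imag m) ^ n • ketZero m n =
              zeta m ^ l • C'.mulVec ((1 + imag m) • x + y) := by
            rw [hCinv, smul_smul, ← mul_assoc, mul_comm (zeta m ^ l), hl, one_mul]
          rw [h3, Matrix.mulVec_add, Matrix.mulVec_smul, Matrix.mulVec_neg]
          module)
      have hy' : y = (zeta m ^ k * (c * (1 + imag m) ^ n)) •
          (C : Matrix (Bits n) (Bits n) (E m)).mulVec (Pi.single b 1) := by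
        rw [← mulVec_inv_mulVec C y, ← Matrix.mulVec_smul]
        congr 1
        rw [mul_smul, ← ey, smul_smul, hl, one_smul]
      obtain ⟨D, hD, eD⟩ := exists_lift_cliffordGroup hm hC
      -- The phase `i c` is chosen because `(1 - i) i = 1 + i`: the generator then sends `|0⟩` to
      -- `(1 + i)/2 * (|0⟩|0⟩ + c |1⟩|b⟩)`.
      obtain ⟨P, hP, p0, p1⟩ := exists_isPauli_mulVec_ketZero (n := n) hm (c := imag m * c)
        (by rw [mul_pow, hc]; linear_combination (imag m ^ 2 - 1) * hI) b
      obtain ⟨U, hU⟩ := exists_isCliffordGenerator hm hP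
      have hi3 : zeta m ^ (k + 2 ^ (m - 2) * 3) = zeta m ^ k * imag m ^ 3 := by
        rw [pow_add, pow_mul]; rfl
      -- The extra exponent is a factor `i^3`, which cancels `(1 + i)^2 / 2 = i`.
      refine ⟨k + 2 ^ (m - 2) * 3, D * U, mul_mem hD hU.mem, half_ext ?_ ?_⟩
      · rw [e0, e, half_smul, mul_mulVec, eD, hU.mulVec, half_add, half_smul, half_smul, p0,
          smul_zero, add_zero, half_zero_ketZero, Matrix.mulVec_smul, smul_smul, hi3]
        congr 1
        rw [pow_succ]
        linear_combination (-(1 / 2) * zeta m ^ k * (1 + imag m) ^ n *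
          (imag m ^ 3 + 2 * imag m ^ 2 - 2)) * hI
      · rw [e1, hy', half_smul, mul_mulVec, eD, hU.mulVec, half_add, half_smul, half_smul, p1,
          half_one_ketZero, smul_zero, zero_add, smul_smul, Matrix.mulVec_smul, smul_smul, hi3]
        congr 1
        rw [pow_succ]
        linear_combination ((1 / 2) * zeta m ^ k * (1 + imag m) ^ n * c *
          (imag m ^ 4 - 2 * imag m ^ 2 + 2)) * hI

end Minimal

end BarnesWall

end

theorem theorem2 (m n : ℕ) (hm : 2 ≤ m) :
    BarnesWall.IsMinimum (BarnesWall.lattice m n)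
      ((Module.finrank ℚ (BarnesWall.E m) : ℚ) / 2 * 2 ^ n) ∧
    ∀ ψ : BarnesWall.Bits n → BarnesWall.E m,
      BarnesWall.IsMinimalVector (BarnesWall.lattice m n) ψ →
        BarnesWall.IsStabilizerState ψ ∧
        ∃ k : ℕ, k < 2 ^ m ∧ ∃ C ∈ BarnesWall.cliffordGroup m n,
          ψ = (BarnesWall.zeta m ^ k * (1 + BarnesWall.imag m) ^ n) •
            (C : Matrix (BarnesWall.Bits n) (BarnesWall.Bits n) (BarnesWall.E m)).mulVec
              (BarnesWall.ketZero m n) := by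
  refine ⟨BarnesWall.isMinimum_lattice hm, fun ψ ⟨hψ, _, hmin⟩ => ?_⟩
  obtain ⟨k, C, hC, rfl⟩ := BarnesWall.exists_clifford_of_traceNorm_eq hm hψ
    (hmin.unique (BarnesWall.isMinimum_lattice hm))
  refine ⟨BarnesWall.isStabilizerState_of_clifford hm hC (mul_ne_zero (pow_ne_zero _ ?_)
    (pow_ne_zero _ (BarnesWall.one_add_imag_ne_zero hm))), k % 2 ^ m,
    Nat.mod_lt _ (by positivity), C, hC, ?_⟩
  · exact (BarnesWall.isPrimitiveRoot_zeta m).ne_zero (by positivity)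
  · have h : BarnesWall.zeta m ^ (k % 2 ^ m) = BarnesWall.zeta m ^ k := by
      conv_rhs => rw [← Nat.div_add_mod k (2 ^ m), pow_add, pow_mul,
        BarnesWall.zeta_pow_two_pow, one_pow, one_mul]
    rw [h]
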